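/- Structures are relational (with an arbitrary signature); a structure is finite if its domain is finite. A finite structure $\mathbb A$ is a core if every endomorphism of $\mathbb A$ is an automorphism. A pp-formula is a formula built from atomic formulas (including equalities) by conjunction and existential quantification. $\mathbb A$ pp-interprets $\mathbb B$ if for some $d\ge 1$ there is a partial surjective map $h\colon A^d\to B$ such that for every $R\subseteq B^n$ that is $B$ itself, the equality relation on $B$, or a relation of $\mathbb B$, the preimage $h^{-1}(R)$, seen as an $nd$-ary relation on $A$, is definable in $\mathbb A$ by a pp-formula without parameters. $\operatorname{Pol}(\mathbb A)$ is the set of all operations $f\colon A^k\to A$ that preserve every relation of $\mathbb A$. $\operatorname{Pol}(\mathbb A)$ satisfies a system of identities $s\approx t$ (with $s,t$ terms over a common set of function symbols of positive arities) if the symbols can be interpreted by members of $\operatorname{Pol}(\mathbb A)$ of the same arities so that every identity holds for all values of the variables in $A$; a system is trivial if it is satisfied in $\operatorname{Pol}(\mathbb C)$ for every structure $\mathbb C$. **Theorem.** Let $\mathbb A$ be a finite core structure and let $m\ge|\operatorname{Aut}(\mathbb A)|$. Then the following are equivalent: 1. $\mathbb A$ does not pp-interpret all finite structures; 2. $\operatorname{Pol}(\mathbb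 A)$ satisfies some nontrivial system of identities; 3. $\operatorname{Pol}(\mathbb A)$ satisfies the single identity $$h(\alpha_1(x),\ldots,\alpha_m(x),x,y,x,z,y,z)\approx h(\underbrace{y,\ldots,y}_{m},y,x,z,x,z,y),$$ where $h$ is an $(m+6)$-ary symbol and $\alpha_1,\ldots,\alpha_m$ are unary symbols. -/

import Mathlib

open FirstOrder

universe u v w u' v' w'

/-- Primitive positive formulas: built from atomic formulas (equalities and relational atoms)
by conjunction and existential quantification only. -/
inductive IsPrimitivePositive {L : FirstOrder.Language.{u, v}} {α : Type u'} :
    ∀ {n : ℕ}, L.BoundedFormula α n → Prop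
  | of_isAtomic {n : ℕ} {φ : L.BoundedFormula α n} (h : φ.IsAtomic) : IsPrimitivePositive φ
  | inf {n : ℕ} {φ ψ : L.BoundedFormula α n} (hφ : IsPrimitivePositive φ)
      (hψ : IsPrimitivePositive ψ) : IsPrimitivePositive (φ ⊓ ψ)
  | ex {n : ℕ} {φ : L.BoundedFormula α (n + 1)} (h : IsPrimitivePositive φ) :
      IsPrimitivePositive φ.ex

/-- The relation `S ⊆ A^α` has a pp-definition (without parameters) in the structure `A`. -/
def IsPPDefinable (L : FirstOrder.Language.{u, v}) {A : Type w} [L.Structure A] {α : Type u'}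
    (S : Set (α → A)) : Prop :=
  ∃ φ : L.Formula α, IsPrimitivePositive φ ∧ ∀ a : α → A, φ.Realize a ↔ a ∈ S

/-- The preimage of an `n`-ary relation `R` on `B` under a partial map `h : A^d → B`, seen as a
relation of arity `n * d` on `A`; the `i`-th block of `d` coordinates of `a` is `a (i, ·)`. -/
def blockPreimage {A : Type w} {B : Type w'} {d n : ℕ} (h : (Fin d → A) →. B)
    (R : Set (Fin n → B)) : Set (Fin n × Fin d → A) :=
  {a | ∃ b ∈ R, ∀ i : Fin n, b i ∈ h (fun j => a (i, j))}

/-- The `L`-structure `A` pp-interprets (without parameters) the `L'`-structure `B`. -/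
def PPInterprets (L : FirstOrder.Language.{u, v}) (A : Type w) [L.Structure A]
    (L' : FirstOrder.Language.{u', v'}) (B : Type w') [L'.Structure B] : Prop :=
  ∃ (d : ℕ) (h : (Fin d → A) →. B),
    1 ≤ d ∧
    (∀ b : B, ∃ a : Fin d → A, b ∈ h a) ∧
    IsPPDefinable L (blockPreimage h (Set.univ : Set (Fin 1 → B))) ∧
    IsPPDefinable L (blockPreimage h {b : Fin 2 → B | b 0 = b 1}) ∧
    ∀ (n : ℕ) (R : L'.Relations n),
      IsPPDefinable L (blockPreimage h {b : Fin n → B | FirstOrder.Language.Structure.RelMap R b})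

/-- The structure `A` pp-interprets every finite (relational) structure, of any signature.
Up to isomorphism and renaming of relation symbols, every finite structure lives in `Type`. -/
def PPInterpretsAllFinite (L : FirstOrder.Language.{u, v}) (A : Type w) [L.Structure A] : Prop :=
  ∀ (L' : FirstOrder.Language.{0, 0}) [L'.IsRelational] (B : Type) [L'.Structure B] [Finite B],
    PPInterprets L A L' B

/-- On every finite set of elements, every endomorphism coincides with some automorphism.
For finite `A` this says that `A` is a core: every endomorphism is an automorphism. -/
def IsModelCompleteCore (L : FirstOrder.Language.{u, v}) (A : Type w) [L.Structure A] : Prop :=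
  ∀ (e : A →[L] A) (F : Finset A), ∃ α : A ≃[L] A, ∀ a ∈ F, e a = α a

/-- The `k`-ary operation `f` on `A` is a polymorphism of the relational structure `A`. -/
def IsPolymorphism (L : FirstOrder.Language.{u, v}) {A : Type w} [L.Structure A] {k : ℕ}
    (f : (Fin k → A) → A) : Prop :=
  ∀ (n : ℕ) (R : L.Relations n) (r : Fin k → Fin n → A),
    (∀ i, FirstOrder.Language.Structure.RelMap R (r i)) →
      FirstOrder.Language.Structure.RelMap R (fun j => f (fun i => r i j))

/-- An equational condition: a set of function symbols of positive arities, together with a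
system of identities `s ≈ t` between terms over these symbols and variables indexed by `ℕ`. -/
structure EquationalCondition where
  symbols : FirstOrder.Language.{0, 0}
  isAlgebraic : symbols.IsAlgebraic
  arity_pos : IsEmpty (symbols.Functions 0)
  identities : Set (symbols.Term ℕ × symbols.Term ℕ)

/-- `Pol(A)` satisfies the equational condition: the function symbols can be interpreted as
polymorphisms of `A` so that all identities hold for every evaluation of the variables. -/
def EquationalCondition.SatisfiedBy (E : EquationalCondition) (L : FirstOrder.Language.{u, v}) (A : Type w)
    [L.Structure A] : Prop :=
  ∃ I : E.symbols.Structure A,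
    (∀ (k : ℕ) (f : E.symbols.Functions k), IsPolymorphism L (I.funMap f)) ∧
    ∀ p ∈ E.identities, ∀ a : ℕ → A, p.1.realize a = p.2.realize a

/-- An equational condition is trivial if it is satisfied in every polymorphism clone. -/
def EquationalCondition.IsTrivial (E : EquationalCondition) : Prop :=
  ∀ (L : FirstOrder.Language.{0, 0}) [L.IsRelational] (C : Type) [L.Structure C], E.SatisfiedBy L C

/-- `Pol(A)` satisfies the single identity
`h(α₁(x), …, αₘ(x), x, y, x, z, y, z) ≈ h(y, …, y, y, x, z, x, z, y)`. -/
def SatisfiesSiggersLikeIdentity (L : FirstOrder.Language.{u, v}) (A : Type w) [L.Structure A] (m : ℕ) :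
    Prop :=
  ∃ (h : (Fin (m + 6) → A) → A) (α : Fin m → (Fin 1 → A) → A),
    IsPolymorphism L h ∧ (∀ i, IsPolymorphism L (α i)) ∧
    ∀ x y z : A,
      h (Fin.append (fun i => α i ![x]) ![x, y, x, z, y, z]) =
        h (Fin.append (fun _ => y) ![y, x, z, x, z, y])

/-! The substance is 1 → 3. Let the polymorphism clone act on its own ternary operations. The
columns of the identity generate an invariant binary relation there, and a loop `p = f(l) = f(r)` of
it is exactly a solution `f`. Six columns are the edges of a triangle on the three projections,
which makes the relation smooth; the columns with `α i` link the first projection to every unary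
operation applied to it. In a core these operations are automorphisms, so `m` of them suffice to
make the relation linked.

The loop theorem says that a finite smooth linked digraph, invariant under a clone whose unary
operations are permutations, has a loop unless the clone maps homomorphically to projections; such a
homomorphism yields pp-interpretations of all finite structures. The proof is by induction on size.
If no idempotent operation is transitive in every argument, some proper subset `P` is forced by one
argument of each idempotent operation: either the forcing argument is always unique and defines the
homomorphism, or `P` is an absorbing subalgebra. An absorbing subalgebra leads to a smaller smooth
linked digraph. With a transitive operation and no absorption, invariant totally symmetric relations
are full, so all vertices have a common out-neighbour, which then has a loop.

For 2 → 1, interpreting the two-element structure with all relations turns polymorphisms into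
projections; 3 → 2 holds because projections fail the identity. -/

/-- An abstract clone, with operations indexed by arbitrary types of arguments. -/
structure AbstractClone where
  Op : Type → Type w
  proj {ι : Type} (i : ι) : Op ι
  comp {ι κ : Type} (f : Op ι) (g : ι → Op κ) : Op κ
  proj_comp {ι κ : Type} (i : ι) (g : ι → Op κ) : comp (proj i) g = g i
  comp_proj {ι : Type} (f : Op ι) : comp f proj = f
  comp_assoc {ι κ μ : Type} (f : Op ι) (g : ι → Op κ) (h : κ → Op μ) :
    comp (comp f g) h = comp f (fun i => comp (g i) h)

/-- An algebra over an abstract clone. -/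
class CloneAction (C : AbstractClone.{w}) (Ω : Type w') where
  act {ι : Type} [Finite ι] : C.Op ι → (ι → Ω) → Ω
  act_proj {ι : Type} [Finite ι] (i : ι) (v : ι → Ω) : act (C.proj i) v = v i
  act_comp {ι κ : Type} [Finite ι] [Finite κ] (f : C.Op ι) (g : ι → C.Op κ) (v : κ → Ω) :
    act (C.comp f g) v = act f (fun i => act (g i) v)


/-- A homomorphism from the clone to the clone of projections. -/
def AbstractClone.HasProjHom (C : AbstractClone.{w}) : Prop :=
  ∃ ξ : ∀ (ι : Type) [Finite ι], C.Op ι → ι,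
    (∀ (ι : Type) [Finite ι] (i : ι), ξ ι (C.proj i) = i) ∧
    ∀ (ι κ : Type) [Finite ι] [Finite κ] (f : C.Op ι) (g : ι → C.Op κ),
      ξ κ (C.comp f g) = ξ κ (g (ξ ι f))

namespace CloneAction

section General

variable {C : AbstractClone.{w}} {Ω : Type w'} [CloneAction C Ω]

/-- The unary operation `x ↦ f(x, …, x)`. -/
def diag {ι : Type} [Finite ι] (f : C.Op ι) (x : Ω) : Ω := act f fun _ => x

variable (C) in
/-- The subset `B` is closed under all operations of finite arity. -/
def IsSubalgebra (B : Set Ω) : Prop :=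
  ∀ (ι : Type) [Finite ι] (f : C.Op ι) (v : ι → Ω), (∀ i, v i ∈ B) → act f v ∈ B

/-- `Z` absorbs the algebra through the operation `f`. -/
def AbsorbedBy {ι : Type} [Finite ι] (Z : Set Ω) (f : C.Op ι) : Prop :=
  ∀ (i : ι) (v : ι → Ω), (∀ j, j ≠ i → v j ∈ Z) → act f v ∈ Z

variable (C) in
/-- The binary relation `R` is a subalgebra of the square. -/
def PreservesRel (R : Ω → Ω → Prop) : Prop :=
  ∀ (ι : Type) [Finite ι] (f : C.Op ι) (v w : ι → Ω), (∀ i, R (v i) (w i)) → R (act f v) (act f w)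

variable (C Ω) in
/-- All unary operations of the algebra are injective. -/
def IsCore : Prop := ∀ (ι : Type) [Finite ι] (f : C.Op ι), Function.Injective (diag (Ω := Ω) f)

def IsTransitiveOp {ι : Type} [Finite ι] (Ω : Type w') [CloneAction C Ω] (t : C.Op ι) : Prop :=
  ∀ (i : ι) (b d : Ω), ∃ v : ι → Ω, v i = b ∧ act t v = d

def IsIdempotentOp {ι : Type} [Finite ι] (Ω : Type w') [CloneAction C Ω] (f : C.Op ι) : Prop :=
  ∀ x : Ω, diag f x = x

end General

/-- A reflexive transitive relation that holds after changing one argument of `F` holds after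
changing finitely many. -/
theorem rel_of_update {ι : Type*} [Finite ι] {α β : Type*} {r : β → β → Prop} (hr : ∀ x, r x x)
    (ht : ∀ x y z, r x y → r y z → r x z) (F : (ι → α) → β) (v w : ι → α)
    (h : ∀ (i : ι) (p q : ι → α), (∀ j, p j = v j ∨ p j = w j) → (∀ j, j ≠ i → p j = q j) →
      p i = v i → q i = w i → r (F p) (F q)) : r (F v) (F w) := by
  classical
  have := Fintype.ofFinite ι
  have key : ∀ s : Finset ι, r (F v) (F fun i => if i ∈ s then w i else v i) := by
    intro s
    induction s using Finset.induction_on with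
    | empty => simpa using hr _
    | insert i s hi ih =>
      refine ht _ _ _ ih (h i _ _ ?_ ?_ ?_ ?_)
      · intro j; by_cases hj : j ∈ s <;> simp [hj]
      · intro j hj; simp [hj]
      · simp [hi]
      · simp
  simpa using key Finset.univ

/-! ### Idempotent operations, transitivity and forced subsets -/

section Core

variable {C : AbstractClone.{w}} {Ω : Type w'} [CloneAction C Ω]

theorem diag_comp {ι κ : Type} [Finite ι] [Finite κ] (f : C.Op ι) (g : ι → C.Op κ) (x : Ω) :
    diag (C.comp f g) x = act f fun i => diag (g i) x :=
  act_comp f g fun _ => x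

theorem exists_act_eq_iterate {ι : Type} [Finite ι] (f : C.Op ι) (n : ℕ) :
    ∃ e : C.Op ι, ∀ v : ι → Ω, act e v = (diag f)^[n] (act f v) := by
  induction n with
  | zero => exact ⟨f, fun v => rfl⟩
  | succ n ih =>
    obtain ⟨e, he⟩ := ih
    refine ⟨C.comp f fun _ => e, fun v => ?_⟩
    rw [act_comp, Function.iterate_succ_apply', ← he]
    rfl

/-- The diagonal of `f` is a permutation of finite order, so its inverse is one of its powers and
can be composed with `f`. -/
theorem exists_idempotent [Finite Ω] (hc : IsCore C Ω) {ι : Type} [Finite ι] (f : C.Op ι) :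
    ∃ e : C.Op ι, IsIdempotentOp Ω e ∧ ∀ v : ι → Ω, act f v = diag f (act e v) := by
  let σ : Equiv.Perm Ω := Equiv.ofBijective (diag f) (Finite.injective_iff_bijective.1 (hc ι f))
  have hσ : ∀ n : ℕ, ∀ x, (diag f)^[n] x = (σ ^ n) x := by
    intro n x
    rw [Equiv.Perm.iterate_eq_pow σ n |>.symm]
    rfl
  have hpos : 0 < orderOf σ := orderOf_pos σ
  obtain ⟨e, he⟩ := exists_act_eq_iterate (Ω := Ω) f (orderOf σ - 1)
  have h1 : ∀ x : Ω, (diag f)^[orderOf σ] x = x := by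
    intro x; rw [hσ, pow_orderOf_eq_one]; rfl
  refine ⟨e, fun x => ?_, fun v => ?_⟩
  · have := he fun _ => x
    change act e _ = x
    rw [this]
    change (diag f)^[orderOf σ - 1] (diag f x) = x
    rw [← Function.iterate_succ_apply, Nat.succ_eq_add_one, Nat.sub_add_cancel hpos, h1]
  · rw [he, ← Function.iterate_succ_apply' (diag f), Nat.succ_eq_add_one,
      Nat.sub_add_cancel hpos, h1]

theorem diag_surjective [Finite Ω] (hc : IsCore C Ω) {ι : Type} [Finite ι] (f : C.Op ι) :
    Function.Surjective (diag (Ω := Ω) f) := Finite.injective_iff_surjective.1 (hc ι f)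

/-- The composition of `f` with itself in all arguments, on independent variables. -/
def star {ι κ : Type} [Finite ι] [Finite κ] (f : C.Op ι) (g : C.Op κ) : C.Op (ι × κ) :=
  C.comp f fun i => C.comp g fun k => C.proj (i, k)

theorem act_star {ι κ : Type} [Finite ι] [Finite κ] (f : C.Op ι) (g : C.Op κ) (v : ι × κ → Ω) :
    act (star f g) v = act f fun i => act g fun k => v (i, k) := by
  simp [star, act_comp, act_proj]

theorem IsIdempotentOp.star {ι κ : Type} [Finite ι] [Finite κ] {f : C.Op ι} {g : C.Op κ} (hf : IsIdempotentOp Ω f)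
    (hg : IsIdempotentOp Ω g) : IsIdempotentOp Ω (star f g) := by
  intro x
  rw [diag, act_star]
  exact (congrArg (act f) (funext fun _ : ι => hg x)).trans (hf x)

/-- By idempotency a star composition inherits the escapes of both factors, so one operation can
serve all subsets. -/
theorem exists_not_subset_of_finset [Finite Ω] (hP : ∀ P : Set Ω, P.Nonempty → P ≠ Set.univ →
      ∃ (ι : Type) (_ : Finite ι) (f : C.Op ι), IsIdempotentOp Ω f ∧
        ∀ i, ∃ v : ι → Ω, v i ∈ P ∧ act f v ∉ P) (S : Finset (Set Ω)) :
    ∃ (ι : Type) (_ : Finite ι) (f : C.Op ι), IsIdempotentOp Ω f ∧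
      ∀ P ∈ S, P.Nonempty → P ≠ Set.univ → ∀ i, ∃ v : ι → Ω, v i ∈ P ∧ act f v ∉ P := by
  classical
  induction S using Finset.induction_on with
  | empty => exact ⟨Unit, inferInstance, C.proj (), fun x => act_proj _ _, by simp⟩
  | insert P S hPS ih =>
    obtain ⟨ι, _, f, hf, hfS⟩ := ih
    by_cases hne : P.Nonempty ∧ P ≠ Set.univ
    · obtain ⟨κ, _, g, hg, hgP⟩ := hP P hne.1 hne.2
      refine ⟨ι × κ, inferInstance, star f g, hf.star hg, ?_⟩
      rintro Q hQ hQ1 hQ2 ⟨i, k⟩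
      rcases Finset.mem_insert.1 hQ with rfl | hQ
      · obtain ⟨v, hv1, hv2⟩ := hgP k
        refine ⟨fun x => v x.2, hv1, ?_⟩
        rw [act_star, show (act f fun _ : ι => act g v) = act g v from hf _]
        exact hv2
      · obtain ⟨v, hv1, hv2⟩ := hfS Q hQ hQ1 hQ2 i
        refine ⟨fun x => v x.1, hv1, ?_⟩
        rw [act_star]
        rwa [show (fun i => act g fun _ => v i) = v from funext fun i => hg (v i)]
    · refine ⟨ι, ‹_›, f, hf, ?_⟩
      intro Q hQ hQ1 hQ2
      rcases Finset.mem_insert.1 hQ with rfl | hQ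
      · exact absurd ⟨hQ1, hQ2⟩ hne
      · exact hfS Q hQ hQ1 hQ2

/-- Either some idempotent operation is transitive in each argument, or some proper subset `P` is
forced by one argument of each idempotent operation. -/
theorem exists_transitive_or [Finite Ω] :
    (∃ (ι : Type) (_ : Finite ι) (t : C.Op ι), IsIdempotentOp Ω t ∧ IsTransitiveOp Ω t) ∨
    ∃ P : Set Ω, P.Nonempty ∧ P ≠ Set.univ ∧ ∀ (ι : Type) [Finite ι] (f : C.Op ι),
      IsIdempotentOp Ω f → ∃ i, ∀ v : ι → Ω, v i ∈ P → act f v ∈ P := by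
  classical
  have := Fintype.ofFinite Ω
  by_contra hcon
  push Not at hcon
  obtain ⟨hT, hP⟩ := hcon
  obtain ⟨κ, _, g, hg, hgP⟩ := exists_not_subset_of_finset (C := C) (Ω := Ω) (fun P h1 h2 => by
    obtain ⟨ι, h, f, hf, hfi⟩ := hP P h1 h2
    exact ⟨ι, h, f, hf, hfi⟩) Finset.univ
  -- Composing with `g` strictly enlarges the set of values reachable with one argument fixed, as
  -- long as this set is proper.
  have key : ∀ m : ℕ, ∃ (ι : Type) (_ : Finite ι) (f : C.Op ι), IsIdempotentOp Ω f ∧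
      ∀ (i : ι) (b : Ω), m ≤ {d | ∃ v : ι → Ω, v i = b ∧ act f v = d}.ncard ∨
        {d | ∃ v : ι → Ω, v i = b ∧ act f v = d} = Set.univ := by
    intro m
    induction m with
    | zero => exact ⟨Unit, inferInstance, C.proj (), fun x => act_proj _ _, by simp⟩
    | succ m ih =>
      obtain ⟨ι, _, f, hf, hfm⟩ := ih
      refine ⟨κ × ι, inferInstance, star g f, hg.star hf, ?_⟩
      rintro ⟨k, i⟩ b
      set X := {d | ∃ v : ι → Ω, v i = b ∧ act f v = d}
      set Y := {d | ∃ v : κ × ι → Ω, v (k, i) = b ∧ act (star g f) v = d}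
      have hXY : X ⊆ Y := by
        rintro d ⟨v, hv, rfl⟩
        refine ⟨fun x => v x.2, hv, ?_⟩
        rw [act_star]
        exact hg (act f v)
      by_cases hX : X = Set.univ
      · right
        exact Set.eq_univ_of_univ_subset (hX ▸ hXY)
      · left
        have hXne : X.Nonempty := ⟨b, fun _ => b, rfl, hf b⟩
        obtain ⟨v, hv1, hv2⟩ := hgP X (Finset.mem_univ _) hXne hX k
        obtain ⟨w, hw1, hw2⟩ := hv1
        have hY : act g v ∈ Y := by
          -- The `k`-th inner copy of `f` takes the value `v k`; the others get constant inputs and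
          -- return `v j`.
          refine ⟨fun x => if x.1 = k then w x.2 else v x.1, by simp [hw1], ?_⟩
          rw [act_star]
          congr 1
          funext j
          by_cases hj : j = k
          · subst hj; simpa using hw2
          · simp only [hj, if_false]
            exact hf (v j)
        have hlt : X.ncard < Y.ncard :=
          Set.ncard_lt_ncard ⟨hXY, fun h => hv2 (h hY)⟩ (Set.toFinite _)
        rcases hfm i b with h | h
        · exact lt_of_le_of_lt h hlt
        · exact absurd h hX
  obtain ⟨ι, hι, t, ht, hm⟩ := key (Nat.card Ω + 1)
  refine hT ι hι t ht ?_
  intro i b d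
  have hu : {d | ∃ v : ι → Ω, v i = b ∧ act t v = d} = Set.univ := by
    refine (hm i b).resolve_left fun h => ?_
    have := Set.ncard_le_card {d | ∃ v : ι → Ω, v i = b ∧ act t v = d}
    omega
  have : d ∈ {d | ∃ v : ι → Ω, v i = b ∧ act t v = d} := hu ▸ Set.mem_univ d
  exact this

/-- The arguments of `f` that force the value of `f` to lie in the copy of `Q`. -/
def forcing {ι : Type} [Finite ι] (Q : Set Ω) (f : C.Op ι) : Set ι :=
  {i | ∀ v : ι → Ω, v i ∈ Q → act f v ∈ diag f '' Q}

theorem image_diag_eq_of_subset [Finite Ω] (hc : IsCore C Ω) {ι κ μ : Type} [Finite ι] [Finite κ] [Finite μ] (f : C.Op ι)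
    (g : C.Op κ) (h : C.Op μ) {P : Set Ω} (hs : diag f '' P ⊆ diag g '' (diag h '' P)) :
    diag f '' P = diag g '' (diag h '' P) := by
  refine Set.eq_of_subset_of_ncard_le hs ?_ (Set.toFinite _)
  rw [Set.ncard_image_of_injective _ (hc _ _), Set.ncard_image_of_injective _ (hc _ _),
    Set.ncard_image_of_injective _ (hc _ _)]

theorem image_diag_proj {P : Set Ω} : diag (C.proj ()) '' P = P := by
  simp [Set.image, diag, act_proj]

/-! ### A forced subset gives projections or absorption -/

section Forced

variable {P : Set Ω}

/-- The operation `f(h₁(x₁), …, hₙ(xₙ))`. -/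
def twist {ι : Type} [Finite ι] (f : C.Op ι) (h : ι → C.Op Unit) : C.Op ι :=
  C.comp f fun i => C.comp (h i) fun _ => C.proj i

theorem act_twist {ι : Type} [Finite ι] (f : C.Op ι) (h : ι → C.Op Unit) (v : ι → Ω) :
    act (twist f h) v = act f fun i => diag (h i) (v i) := by
  simp [twist, act_comp, act_proj, diag]

/-- Feeding `γ'` at `i'` and `γ` elsewhere puts one image of `P` inside both translates under `f`;
all have the size of `P`, and `diag f` is injective. -/
theorem eq_of_mem_forcing [Finite Ω] (hc : IsCore C Ω)
    {ι : Type} [Finite ι] (f : C.Op ι) (γ γ' : C.Op Unit) {i i' : ι} (hne : i ≠ i')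
    (hi : i ∈ forcing (diag γ '' P) f) (hi' : i' ∈ forcing (diag γ' '' P) f) :
    diag γ '' P = diag γ' '' P := by
  classical
  let F := twist f fun j => if j = i' then γ' else γ
  have hF : ∀ x : Ω, diag F x = act f fun j => diag (if j = i' then γ' else γ) x :=
    fun x => act_twist _ _ _
  have h1 : diag F '' P ⊆ diag f '' (diag γ '' P) := by
    rintro _ ⟨x, hx, rfl⟩
    rw [hF]
    exact hi _ (by simpa [hne] using Set.mem_image_of_mem _ hx)
  have h2 : diag F '' P ⊆ diag f '' (diag γ' '' P) := by
    rintro _ ⟨x, hx, rfl⟩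
    rw [hF]
    exact hi' _ (by simpa using Set.mem_image_of_mem _ hx)
  have := (image_diag_eq_of_subset hc _ _ _ h1).symm.trans (image_diag_eq_of_subset hc _ _ _ h2)
  exact (hc _ f).image_injective this

theorem exists_forcing_twist [Finite Ω] (hc : IsCore C Ω)
    (hP : ∀ (ι : Type) [Finite ι] (f : C.Op ι), IsIdempotentOp Ω f →
      ∃ i, ∀ v : ι → Ω, v i ∈ P → act f v ∈ P)
    {ι : Type} [Finite ι] (f : C.Op ι) (h : ι → C.Op Unit) :
    ∃ i, ∀ w : ι → Ω, w i ∈ diag (h i) '' P → act f w ∈ diag (twist f h) '' P := by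
  obtain ⟨e, he, hfe⟩ := exists_idempotent hc (twist f h)
  obtain ⟨i, hi⟩ := hP ι e he
  refine ⟨i, fun w hw => ?_⟩
  choose v hv using fun j => diag_surjective hc (h j) (w j)
  have hw' : w = fun j => diag (h j) (v j) := funext fun j => (hv j).symm
  have hvi : v i ∈ P := by
    obtain ⟨x, hx, hxw⟩ := hw
    rwa [hc _ (h i) ((hv i).trans hxw.symm)]
  rw [hw', ← act_twist, hfe]
  exact Set.mem_image_of_mem _ (hi v hvi)

theorem forcing_nonempty [Finite Ω] (hc : IsCore C Ω)
    (hP : ∀ (ι : Type) [Finite ι] (f : C.Op ι), IsIdempotentOp Ω f →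
      ∃ i, ∀ v : ι → Ω, v i ∈ P → act f v ∈ P)
    {ι : Type} [Finite ι] (f : C.Op ι) (γ : C.Op Unit) :
    (forcing (diag γ '' P) f).Nonempty := by
  obtain ⟨i, hi⟩ := exists_forcing_twist hc hP f fun _ => γ
  refine ⟨i, fun v hv => ?_⟩
  obtain ⟨x, hx, hxv⟩ := hi v hv
  refine ⟨diag γ x, Set.mem_image_of_mem _ hx, ?_⟩
  rw [← hxv]
  exact (act_twist f (fun _ => γ) fun _ => x).symm

/-- Each operation is sent to its unique forcing argument. -/
theorem hasProjHom_of_forcing_subsingleton [Finite Ω] (hc : IsCore C Ω)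
    (hP : ∀ (ι : Type) [Finite ι] (f : C.Op ι), IsIdempotentOp Ω f →
      ∃ i, ∀ v : ι → Ω, v i ∈ P → act f v ∈ P)
    (hs : ∀ (ι : Type) [Finite ι] (f : C.Op ι), (forcing P f).Subsingleton) : C.HasProjHom := by
  have hne : ∀ (ι : Type) [Finite ι] (f : C.Op ι), (forcing P f).Nonempty := by
    intro ι _ f
    simpa [image_diag_proj] using forcing_nonempty hc hP f (C.proj ())
  choose ξ hξ using hne
  have huniq : ∀ (ι : Type) [Finite ι] (f : C.Op ι) (γ : C.Op Unit) (i : ι),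
      i ∈ forcing (diag γ '' P) f → i = ξ ι f := by
    intro ι _ f γ i hi
    by_contra hne
    have hξ' : ξ ι f ∈ forcing (diag (C.proj ()) '' P) f := by
      rw [image_diag_proj]; exact hξ ι f
    have hQ := eq_of_mem_forcing hc f γ (C.proj ()) hne hi hξ'
    rw [hQ, image_diag_proj] at hi
    exact hne (hs ι f hi (hξ ι f))
  -- The argument that forces the twist also forces the translate of `P` by its own `h i`, so it is
  -- `ξ ι f`.
  have htwist : ∀ (ι : Type) [Finite ι] (f : C.Op ι) (h : ι → C.Op Unit) (w : ι → Ω),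
      w (ξ ι f) ∈ diag (h (ξ ι f)) '' P → act f w ∈ diag (twist f h) '' P := by
    intro ι _ f h
    obtain ⟨i, hi⟩ := exists_forcing_twist hc hP f h
    have hsub : diag f '' (diag (h i) '' P) ⊆ diag (twist f h) '' P := by
      rintro _ ⟨q, hq, rfl⟩
      exact hi _ hq
    have heq : diag f '' (diag (h i) '' P) = diag (twist f h) '' P := by
      refine Set.eq_of_subset_of_ncard_le hsub ?_ (Set.toFinite _)
      rw [Set.ncard_image_of_injective _ (hc _ _), Set.ncard_image_of_injective _ (hc _ _),
        Set.ncard_image_of_injective _ (hc _ _)]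
    have : i ∈ forcing (diag (h i) '' P) f := fun v hv => by rw [heq]; exact hi v hv
    rw [← huniq ι f (h i) i this]
    exact hi
  refine ⟨fun ι _ => ξ ι, ?_, ?_⟩
  · intro ι _ i
    refine hs ι (C.proj i) (hξ ι _) fun v hv => ⟨v i, hv, ?_⟩
    simp [diag, act_proj]
  · intro ι κ _ _ f g
    refine hs κ _ (hξ κ _) fun v hv => ?_
    rw [act_comp]
    let h : ι → C.Op Unit := fun i => C.comp (g i) fun _ => C.proj ()
    have hh : ∀ i (x : Ω), diag (h i) x = diag (g i) x := by
      intro i x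
      simp [h, diag, act_comp, act_proj]
    have hF : ∀ x : Ω, diag (twist f h) x = diag (C.comp f g) x := by
      intro x
      rw [diag, act_twist, diag_comp]
      simp only [hh]
    have := htwist ι f h (fun i => act (g i) v) ?_
    · rwa [show diag (twist f h) = diag (C.comp f g) from funext hF] at this
    · rw [show diag (h (ξ ι f)) = diag (g (ξ ι f)) from funext (hh _)]
      exact hξ κ (g (ξ ι f)) v hv

/-- An argument forcing a translate of `P` differs from `i` or from `i'`, so the translate equals
`P`. Then every operation has an argument forcing values into `P` itself, and identifying arguments
of `f` so as to separate `i` from `i'` gives a binary absorbing operation. -/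
theorem exists_absorbing_of_forcing [Finite Ω] (hc : IsCore C Ω)
    (hP : ∀ (ι : Type) [Finite ι] (f : C.Op ι), IsIdempotentOp Ω f →
      ∃ i, ∀ v : ι → Ω, v i ∈ P → act f v ∈ P)
    {ι : Type} [Finite ι] (f : C.Op ι) {i i' : ι}
    (hi : i ∈ forcing P f) (hi' : i' ∈ forcing P f) (hne : i ≠ i') :
    IsSubalgebra C P ∧ ∃ b : C.Op Bool, AbsorbedBy P b := by
  classical
  have himg : ∀ γ : C.Op Unit, diag γ '' P = P := by
    intro γ
    obtain ⟨j, hj⟩ := forcing_nonempty hc hP f γ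
    rw [← image_diag_proj (C := C) (P := P)] at hi hi'
    conv_rhs => rw [← image_diag_proj (C := C) (P := P)]
    by_cases hji : j = i
    · exact eq_of_mem_forcing hc f γ (C.proj ()) (hji ▸ hne) hj hi'
    · exact eq_of_mem_forcing hc f γ (C.proj ()) hji hj hi
  have himg' : ∀ (κ : Type) [Finite κ] (g : C.Op κ), diag g '' P = P := by
    intro κ _ g
    have := himg (C.comp g fun _ => C.proj ())
    have h2 : diag (Ω := Ω) (C.comp g fun _ => C.proj ()) = diag g := by
      funext x
      simp [diag, act_comp, act_proj]
    rwa [h2] at this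
  refine ⟨fun κ _ g v hv => ?_, C.comp f fun j => if j = i then C.proj true else C.proj false,
    fun k v hv => ?_⟩
  · obtain ⟨j, hj⟩ := forcing_nonempty hc hP g (C.proj ())
    rw [image_diag_proj] at hj
    rw [← himg' κ g]
    exact hj v (hv j)
  · rw [act_comp, ← himg' ι f]
    cases k with
    | false => exact hi _ (by simpa [act_proj] using hv true (by simp))
    | true => exact hi' _ (by simpa [act_proj, hne.symm] using hv false (by simp))

end Forced

end Core

end CloneAction

namespace CloneAction

/-! ### Absorbing subalgebras and restriction of linked digraphs -/

section Absorption

variable {C : AbstractClone.{w}} {Ω : Type w'} [CloneAction C Ω]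

/-- Two elements with a common out-neighbour. -/
def Forked (R : Ω → Ω → Prop) (x y : Ω) : Prop := ∃ z, R x z ∧ R y z

/-- Any two elements are joined by a chain of forks. -/
def IsLinked (R : Ω → Ω → Prop) : Prop := ∀ x y, Relation.ReflTransGen (Forked R) x y

/-- The relation is subdirect. -/
def IsSmooth (R : Ω → Ω → Prop) : Prop := (∀ x, ∃ y, R x y) ∧ ∀ y, ∃ x, R x y

theorem IsSmooth.flip {R : Ω → Ω → Prop} (hR : IsSmooth R) : IsSmooth (flip R) := ⟨hR.2, hR.1⟩

theorem IsLinked.flip {R : Ω → Ω → Prop} (hs : IsSmooth R) (hl : IsLinked R) :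
    IsLinked (flip R) := by
  intro x y
  obtain ⟨x', hx⟩ := hs.2 x
  obtain ⟨y', hy⟩ := hs.2 y
  have key : ∀ z, Relation.ReflTransGen (Forked R) x' z →
      ∀ u, R z u → Relation.ReflTransGen (Forked (Function.swap R)) x u := by
    intro z hz
    induction hz with
    | refl => exact fun u hu => .single ⟨x', hx, hu⟩
    | tail _ h ih =>
      obtain ⟨e, h1, h2⟩ := h
      exact fun u hu => (ih e h1).tail ⟨_, h2, hu⟩
  exact key y' (hl x' y') y hy

theorem PreservesRel.flip {R : Ω → Ω → Prop} (h : PreservesRel C R) : PreservesRel C (flip R) :=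
  fun ι _ f v w hvw => h ι f w v hvw

theorem IsSubalgebra.image {R : Ω → Ω → Prop} (hR : PreservesRel C R) {B : Set Ω}
    (hB : IsSubalgebra C B) : IsSubalgebra C {y | ∃ x ∈ B, R x y} := by
  intro ι _ f v hv
  choose x hx hxv using hv
  exact ⟨act f x, hB ι f x hx, hR ι f x v hxv⟩

theorem AbsorbedBy.image {R : Ω → Ω → Prop} (hR : PreservesRel C R) (hs : IsSmooth R)
    {ι : Type} [Finite ι] {f : C.Op ι} {B : Set Ω} (hB : AbsorbedBy B f) :
    AbsorbedBy {y | ∃ x ∈ B, R x y} f := by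
  intro i v hv
  have : ∀ j, ∃ x, R x (v j) ∧ (j ≠ i → x ∈ B) := by
    intro j
    by_cases hj : j = i
    · obtain ⟨x, hx⟩ := hs.2 (v j)
      exact ⟨x, hx, fun h => absurd hj h⟩
    · obtain ⟨x, hx, hxv⟩ := hv j hj
      exact ⟨x, hxv, fun _ => hx⟩
  choose x hx hxB using this
  exact ⟨act f x, hB i x hxB, hR ι f x v hx⟩

/-- Take a maximal proper absorbing `B`. If neither `B` nor its image works, going forth and back
along `R` stays in `B`, so `B` is closed under forks, against linkedness. -/
theorem exists_image_eq_univ [Finite Ω] {R : Ω → Ω → Prop} (hR : PreservesRel C R)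
    (hs : IsSmooth R) (hl : IsLinked R) {ι : Type} [Finite ι] {f : C.Op ι} {Z : Set Ω}
    (hZ : IsSubalgebra C Z) (hZf : AbsorbedBy Z f) (hne : Z.Nonempty) (hZu : Z ≠ Set.univ) :
    ∃ B : Set Ω, IsSubalgebra C B ∧ AbsorbedBy B f ∧ B.Nonempty ∧ B ≠ Set.univ ∧
      ({y | ∃ x ∈ B, R x y} = Set.univ ∨ {y | ∃ x ∈ B, flip R x y} = Set.univ) := by
  obtain ⟨B, hB⟩ := (Set.toFinite {B : Set Ω | IsSubalgebra C B ∧ AbsorbedBy B f ∧ B.Nonempty ∧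
    B ≠ Set.univ}).exists_maximal ⟨Z, hZ, hZf, hne, hZu⟩
  obtain ⟨⟨hB1, hB2, hB3, hB4⟩, hmax⟩ := hB
  set D := {y | ∃ x ∈ B, R x y} with hD
  have hDne : D.Nonempty := by
    obtain ⟨b, hb⟩ := hB3
    obtain ⟨y, hy⟩ := hs.1 b
    exact ⟨y, b, hb, hy⟩
  set E := {y | ∃ x ∈ D, flip R x y} with hE
  have hBE : B ⊆ E := by
    intro b hb
    obtain ⟨y, hy⟩ := hs.1 b
    exact ⟨y, ⟨b, hb, hy⟩, hy⟩
  have hE1 : IsSubalgebra C E := (hB1.image hR).image hR.flip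
  have hE2 : AbsorbedBy E f := (hB2.image hR hs).image hR.flip hs.flip
  by_cases hDu : D = Set.univ
  · exact ⟨B, hB1, hB2, hB3, hB4, Or.inl hDu⟩
  by_cases hEu : E = Set.univ
  · exact ⟨D, hB1.image hR, hB2.image hR hs, hDne, hDu, Or.inr hEu⟩
  have hEB : E ⊆ B := hmax ⟨hE1, hE2, hB3.mono hBE, hEu⟩ hBE
  refine absurd (Set.eq_univ_of_forall fun y => ?_) hB4
  obtain ⟨b, hb⟩ := hB3
  have := hl b y
  induction this with
  | refl => exact hb
  | tail _ h ih =>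
    obtain ⟨z, hz1, hz2⟩ := h
    exact hEB ⟨z, ⟨_, ih, hz1⟩, hz2⟩

theorem exists_restriction_of_image [Finite Ω] (hc : IsCore C Ω) {R : Ω → Ω → Prop}
    (hR : PreservesRel C R) (hs : IsSmooth R) (hl : IsLinked R) {ι : Type} [Finite ι]
    {f : C.Op ι} {Z : Set Ω} (hZ : IsSubalgebra C Z) (hZf : AbsorbedBy Z f) (hne : Z.Nonempty)
    (hZu : Z ≠ Set.univ) (hZR : {y | ∃ x ∈ Z, R x y} = Set.univ) :
    ∃ B : Set Ω, IsSubalgebra C B ∧ B.Nonempty ∧ B ≠ Set.univ ∧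
      IsSmooth (fun x y : B => R x y) ∧ IsLinked (fun x y : B => R x y) := by
  -- Minimality supplies out-neighbours: the elements of `B` with an out-neighbour in `B` satisfy
  -- the same conditions.
  obtain ⟨B, hB⟩ := (Set.toFinite {B : Set Ω | IsSubalgebra C B ∧ AbsorbedBy B f ∧ B.Nonempty ∧
    B ≠ Set.univ ∧ ∀ b ∈ B, ∃ b' ∈ B, R b' b}).exists_minimal ⟨Z, hZ, hZf, hne, hZu, fun b _ => by
      have : b ∈ {y | ∃ x ∈ Z, R x y} := hZR ▸ Set.mem_univ b
      exact this⟩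
  obtain ⟨⟨hB1, hB2, hB3, hB4, hB5⟩, hmin⟩ := hB
  have hout : ∀ b ∈ B, ∃ b' ∈ B, R b b' := by
    have hsub : {b | b ∈ B ∧ ∃ b' ∈ B, R b b'} ⊆ B := fun b hb => hb.1
    refine fun b hb => (hmin ⟨?_, ?_, ?_, ?_, ?_⟩ hsub hb).2
    · exact fun κ _ g v hv => ⟨hB1 κ g v fun i => (hv i).1,
        (hB1.image hR.flip) κ g v fun i => (hv i).2⟩
    · exact fun i v hv => ⟨hB2 i v fun j hj => (hv j hj).1,
        (hB2.image hR.flip hs.flip) i v fun j hj => (hv j hj).2⟩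
    · obtain ⟨b, hb⟩ := hB3
      obtain ⟨b', hb', h⟩ := hB5 b hb
      exact ⟨b', hb', b, hb, h⟩
    · exact fun h => hB4 (Set.eq_univ_of_univ_subset (h ▸ hsub))
    · rintro b ⟨hb, -⟩
      obtain ⟨b', hb', h⟩ := hB5 b hb
      exact ⟨b', ⟨hb', b, hb, h⟩, h⟩
  have hsm : IsSmooth (fun x y : B => R x y) := by
    constructor
    · rintro ⟨b, hb⟩
      obtain ⟨b', hb', h⟩ := hout b hb
      exact ⟨⟨b', hb'⟩, h⟩
    · rintro ⟨b, hb⟩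
      obtain ⟨b', hb', h⟩ := hB5 b hb
      exact ⟨⟨b', hb'⟩, h⟩
  refine ⟨B, hB1, hB3, hB4, hsm, ?_⟩
  let r : Ω → Ω → Prop := Relation.ReflTransGen fun x y => x ∈ B ∧ y ∈ B ∧ ∃ z ∈ B, R x z ∧ R y z
  have hstep : ∀ (i : ι) (p q : ι → Ω), (∀ j, p j ∈ B) → (∀ j, q j ∈ B) →
      (∀ j, j ≠ i → p j = q j) → r (act f p) (act f q) := by
    classical
    intro i p q hp hq hpq
    have hmem : ∀ c, act f (Function.update p i c) ∈ B := fun c => hB2 i _ fun j hj => by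
      rw [Function.update_of_ne hj]; exact hp j
    -- A linking chain of the whole algebra runs through argument `i`. The other arguments stay in
    -- `B`, so absorption pulls the chain and its fork tips into `B`.
    have hchain : ∀ c, Relation.ReflTransGen (Forked R) (p i) c →
        r (act f (Function.update p i (p i))) (act f (Function.update p i c)) := by
      intro c hpc
      induction hpc with
      | refl => exact .refl
      | tail _ h ih =>
        obtain ⟨e, h1, h2⟩ := h
        choose! o ho1 ho2 using hout
        refine ih.tail ⟨hmem _, hmem _, act f (Function.update (fun j => o (p j)) i e), ?_, ?_, ?_⟩
        · refine hB2 i _ fun j hj => ?_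
          rw [Function.update_of_ne hj]
          exact ho1 _ (hp j)
        all_goals
          refine hR ι f _ _ fun j => ?_
          by_cases hj : j = i
          · subst hj; simpa
          · simpa [hj] using ho2 _ (hp j)
    have h := hchain (q i) (hl _ _)
    rwa [Function.update_eq_self, show Function.update p i (q i) = q from by
      funext j
      by_cases hj : j = i
      · subst hj; simp
      · simp [hj, hpq j hj] ] at h
  have hrel : ∀ b ∈ B, ∀ b' ∈ B, r (diag f b) (diag f b') := by
    intro b hb b' hb'
    refine rel_of_update (r := r) (fun _ => .refl) (fun _ _ _ => .trans) (act f) _ _ ?_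
    intro i p q hp hpq h1 h2
    have hpB : ∀ j, p j ∈ B := fun j => by rcases hp j with h | h <;> rw [h] <;> assumption
    refine hstep i p q hpB (fun j => ?_) hpq
    by_cases hj : j = i
    · rw [hj, h2]; exact hb'
    · rw [← hpq j hj]; exact hpB j
  -- As `diag f` permutes `B`, linking the diagonal values links all of `B`.
  have himg : diag f '' B = B := by
    refine Set.eq_of_subset_of_ncard_le ?_ (Set.ncard_image_of_injective _ (hc _ f)).ge
      (Set.toFinite _)
    rintro _ ⟨x, hx, rfl⟩
    exact hB1 ι f _ fun _ => hx
  rintro ⟨x, hx⟩ ⟨y, hy⟩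
  obtain ⟨x', hx', rfl⟩ : x ∈ diag f '' B := himg.symm ▸ hx
  have key : ∀ y, r (diag f x') y → ∀ hy : y ∈ B, Relation.ReflTransGen
      (Forked fun x y : B => R x y) ⟨diag f x', hx⟩ ⟨y, hy⟩ := by
    intro y hr
    induction hr with
    | refl => exact fun _ => .refl
    | tail _ h ih =>
      obtain ⟨h1, h2, z, hz, h3⟩ := h
      exact fun _ => (ih h1).tail ⟨⟨z, hz⟩, h3⟩
  refine key y ?_ hy
  obtain ⟨y', hy', rfl⟩ : y ∈ diag f '' B := himg.symm ▸ hy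
  exact hrel x' hx' y' hy'

theorem exists_restriction [Finite Ω] (hc : IsCore C Ω) {R : Ω → Ω → Prop}
    (hR : PreservesRel C R) (hs : IsSmooth R) (hl : IsLinked R) {ι : Type} [Finite ι]
    {f : C.Op ι} {Z : Set Ω} (hZ : IsSubalgebra C Z) (hZf : AbsorbedBy Z f) (hne : Z.Nonempty)
    (hZu : Z ≠ Set.univ) :
    ∃ B : Set Ω, IsSubalgebra C B ∧ B.Nonempty ∧ B ≠ Set.univ ∧
      IsSmooth (fun x y : B => R x y) ∧ IsLinked (fun x y : B => R x y) := by
  obtain ⟨D, hD1, hD2, hD3, hD4, hD | hD⟩ := exists_image_eq_univ hR hs hl hZ hZf hne hZu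
  · exact exists_restriction_of_image hc hR hs hl hD1 hD2 hD3 hD4 hD
  · obtain ⟨B, h1, h2, h3, h4, h5⟩ :=
      exists_restriction_of_image hc hR.flip hs.flip (IsLinked.flip hs hl) hD1 hD2 hD3 hD4 hD
    exact ⟨B, h1, h2, h3, h4.flip, IsLinked.flip h4 h5⟩

/-- The restriction of an algebra to a subalgebra. -/
@[reducible] def IsSubalgebra.action {B : Set Ω} (hB : IsSubalgebra C B) : CloneAction C B where
  act f v := ⟨act f fun i => (v i : Ω), hB _ f _ fun i => (v i).2⟩
  act_proj i _ := Subtype.ext (act_proj i _)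
  act_comp f g _ := Subtype.ext (act_comp f g _)

end Absorption

end CloneAction

namespace CloneAction

/-! ### Totally symmetric relations without absorption -/

section TotallySymmetric

variable {C : AbstractClone.{w}} {Ω : Type w'} [CloneAction C Ω] [DecidableEq Ω]

variable (C) in
/-- A totally symmetric and totally reflexive invariant relation of arity `n`, given by the finite
sets whose enumerations of length `n` belong to the relation. -/
structure IsTotallySymmetric (n : ℕ) (K : Finset Ω → Prop) : Prop where
  mono : ∀ X Y, X ⊆ Y → K Y → K X
  small : ∀ X, X.card < n → K X
  inv : ∀ (ι : Type) [Finite ι] (f : C.Op ι) (Y : Finset Ω) (w : Ω → ι → Ω), Y.card ≤ n →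
    (∀ y ∈ Y, act f (w y) = y) → (∀ i, K (Y.image fun y => w y i)) → K Y

/-- Sets `X` for which some `z` is compatible with all subsets of `X` of size less than `n`. -/
def Extends (n : ℕ) (K : Finset Ω → Prop) (X : Finset Ω) : Prop :=
  ∃ z, ∀ Y ⊆ X, Y.card < n → K (insert z Y)

theorem Extends.mono {n : ℕ} {K : Finset Ω → Prop} {X Y : Finset Ω} (h : X ⊆ Y)
    (hY : Extends n K Y) : Extends n K X := by
  obtain ⟨z, hz⟩ := hY
  exact ⟨z, fun W hW => hz W (hW.trans h)⟩

namespace IsTotallySymmetric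

variable {n : ℕ} {K : Finset Ω → Prop}

theorem le_extends [Nonempty Ω] (hK : IsTotallySymmetric C n K) (hn : 2 ≤ n) {X : Finset Ω}
    (hX : K X) : Extends n K X := by
  rcases X.eq_empty_or_nonempty with rfl | ⟨z, hz⟩
  · refine ⟨Classical.arbitrary Ω, fun Y hY _ => hK.small _ ?_⟩
    rw [Finset.subset_empty.1 hY]
    simp
    omega
  · exact ⟨z, fun Y hY _ => hK.mono _ _ (Finset.insert_subset hz hY) hX⟩

/-- The witnesses of the columns combine to `act f z`. If that element already occurs in the set,
its row is replaced by `z`. -/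
theorem extends_inv (hK : IsTotallySymmetric C n K) (ι : Type) [Finite ι] (f : C.Op ι)
    (Y : Finset Ω) (w : Ω → ι → Ω) (hw : ∀ y ∈ Y, act f (w y) = y)
    (h : ∀ i, Extends n K (Y.image fun y => w y i)) : Extends n K Y := by
  choose z hz using h
  refine ⟨act f z, fun Y' hY' hc => ?_⟩
  refine hK.inv ι f _ (fun y => if y = act f z then z else w y)
    ((Finset.card_insert_le _ _).trans hc) ?_ fun i => ?_
  · intro y hy
    by_cases h : y = act f z
    · simp [h]
    · simpa [h] using hw y (hY' ((Finset.mem_insert.1 hy).resolve_left h))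
  · refine hK.mono _ _ ?_ (hz i (Y'.image fun y => w y i) (Finset.image_subset_image hY')
      (Finset.card_image_le.trans_lt hc))
    intro x hx
    obtain ⟨y, hy, rfl⟩ := Finset.mem_image.1 hx
    by_cases h : y = act f z
    · simp [h]
    · simp only [h, if_false]
      exact Finset.mem_insert_of_mem
        (Finset.mem_image_of_mem _ ((Finset.mem_insert.1 hy).resolve_left h))

/-- Elements other than `act f v` get constant rows, because diagonals are surjective; column `i`
then contains the central `v i` and fewer than `n` others. -/
theorem isSubalgebra_center [Finite Ω] (hc : IsCore C Ω) (hK : IsTotallySymmetric C n K) :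
    IsSubalgebra C {z | ∀ Y : Finset Ω, Y.card < n → K (insert z Y)} := by
  intro ι _ f v hv Y hY
  choose s hs using diag_surjective hc f
  refine hK.inv ι f _ (fun y => if y = act f v then v else fun _ => s y)
    ((Finset.card_insert_le _ _).trans hY) ?_ fun i => ?_
  · intro y _
    by_cases h : y = act f v
    · simp [h]
    · simp only [h, if_false]
      exact hs y
  · refine hK.mono _ _ ?_ (hv i (Y.image s) (Finset.card_image_le.trans_lt hY))
    intro x hx
    obtain ⟨y, hy, rfl⟩ := Finset.mem_image.1 hx
    by_cases h : y = act f v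
    · simp [h]
    · simp only [h, if_false]
      exact Finset.mem_insert_of_mem
        (Finset.mem_image_of_mem _ ((Finset.mem_insert.1 hy).resolve_left h))

/-- Transitivity writes some `y₀ ∈ Y` as a value of `t` with the same `i`-th argument as `v`. Column
`i` thus has a repetition and is small; the other columns contain a central element. -/
theorem absorbedBy_center (hn : 2 ≤ n) (hK : IsTotallySymmetric C n K) {ι : Type} [Finite ι]
    {t : C.Op ι} (ht : IsIdempotentOp Ω t) (htr : IsTransitiveOp Ω t) :
    AbsorbedBy {z | ∀ Y : Finset Ω, Y.card < n → K (insert z Y)} t := by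
  intro i v hv Y hY
  by_cases hY' : ∃ y ∈ Y, y ≠ act t v
  · obtain ⟨y₀, hy₀, hne⟩ := hY'
    obtain ⟨r, hr, hry⟩ := htr i (v i) y₀
    refine hK.inv ι t _ (fun y => if y = act t v then v else if y = y₀ then r else fun _ => y)
      ((Finset.card_insert_le _ _).trans hY) ?_ fun j => ?_
    · intro y _
      by_cases h : y = act t v
      · simp [h]
      · by_cases h' : y = y₀
        · simpa [h', hne] using hry
        · simp only [h, h', if_false]
          exact ht y
    · by_cases hj : j = i
      · subst hj
        refine hK.small _ (lt_of_le_of_lt (Finset.card_le_card ?_)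
          ((Finset.card_image_le (s := Y) (f := fun y => (if y = act t v then v else
            if y = y₀ then r else fun _ => y) j)).trans_lt hY))
        intro x hx
        obtain ⟨y, hy, rfl⟩ := Finset.mem_image.1 hx
        rcases Finset.mem_insert.1 hy with rfl | hy
        · exact Finset.mem_image.2 ⟨y₀, hy₀, by simp [hne, hr]⟩
        · exact Finset.mem_image_of_mem _ hy
      · refine hK.mono _ _ ?_ (hv j hj (Y.image fun y => (if y = y₀ then r else fun _ => y) j)
          (Finset.card_image_le.trans_lt hY))
        intro x hx
        obtain ⟨y, hy, rfl⟩ := Finset.mem_image.1 hx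
        by_cases h : y = act t v
        · simp [h]
        · simp only [h, if_false]
          exact Finset.mem_insert_of_mem
            (Finset.mem_image_of_mem _ ((Finset.mem_insert.1 hy).resolve_left h))
  · push Not at hY'
    refine hK.small _ (lt_of_le_of_lt (Finset.card_le_card (t := {act t v}) ?_) ?_)
    · intro y hy
      rcases Finset.mem_insert.1 hy with rfl | hy
      · simp
      · simpa using hY' y hy
    · simp; omega

/-- Two elements that lie together in the relation with any others. -/
def Twin (n : ℕ) (K : Finset Ω → Prop) (a b : Ω) : Prop :=
  ∀ W : Finset Ω, W.card + 2 ≤ n → K (insert a (insert b W))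

theorem twin_refl (hK : IsTotallySymmetric C n K) (a : Ω) : Twin n K a a := by
  intro W hW
  refine hK.small _ ?_
  rw [Finset.insert_idem]
  have := Finset.card_insert_le a W
  omega

/-- The middle element `b` is the witness required by `Extends`. -/
theorem twin_trans (hK : IsTotallySymmetric C n K) (hext : ∀ X, Extends n K X → K X) {a b c : Ω}
    (hab : Twin n K a b) (hbc : Twin n K b c) : Twin n K a c := by
  intro W hW
  refine hext _ ⟨b, fun Y hY hYn => ?_⟩
  by_cases ha : a ∈ Y
  · have := hab (Y.erase a) (by rw [Finset.card_erase_of_mem ha]; omega)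
    rwa [Finset.insert_comm, Finset.insert_erase ha] at this
  by_cases hc : c ∈ Y
  · have := hbc (Y.erase c) (by rw [Finset.card_erase_of_mem hc]; omega)
    rwa [Finset.insert_erase hc] at this
  refine hK.small _ ?_
  have h1 : Y ⊆ W := by
    intro y hy
    rcases Finset.mem_insert.1 (hY hy) with rfl | hy'
    · exact absurd hy ha
    rcases Finset.mem_insert.1 hy' with rfl | hy'
    · exact absurd hy hc
    exact hy'
  have h2 := Finset.card_le_card h1
  have h3 := Finset.card_insert_le b Y
  omega

/-- Since `n ≥ 3`, there is `w₀ ∈ W`, and a row for it can agree with `p` at `i`. Every column then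
repeats an entry: `p` with `q` off `i`, and `p` with `r` at `i`. -/
theorem twin_act (hn : 3 ≤ n) (hK : IsTotallySymmetric C n K) {ι : Type} [Finite ι]
    {t : C.Op ι} (ht : IsIdempotentOp Ω t) (htr : IsTransitiveOp Ω t) (i : ι) (p q : ι → Ω)
    (hpq : ∀ j, j ≠ i → p j = q j) : Twin n K (act t p) (act t q) := by
  intro W hW
  by_cases hs : (insert (act t p) (insert (act t q) W)).card < n
  · exact hK.small _ hs
  have h1 := Finset.card_insert_le (act t p) (insert (act t q) W)
  have h2 := Finset.card_insert_le (act t q) W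
  have hp : act t p ∉ insert (act t q) W := fun h => by
    rw [Finset.insert_eq_of_mem h] at hs; omega
  have hq : act t q ∉ W := fun h => by
    rw [Finset.insert_eq_of_mem h] at hs h1; omega
  obtain ⟨w₀, hw₀⟩ : W.Nonempty := by
    rw [← Finset.card_pos]; omega
  have hp1 : act t q ≠ act t p := fun h => hp (by simp [h])
  have hp2 : w₀ ≠ act t p := by rintro rfl; exact hp (by simp [hw₀])
  have hq2 : w₀ ≠ act t q := by rintro rfl; exact hq hw₀
  obtain ⟨r, hr, hrw⟩ := htr i (p i) w₀
  refine hK.inv ι t _ (fun y => if y = act t p then p else if y = act t q then q else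
    if y = w₀ then r else fun _ => y) (by omega) ?_ fun j => hK.small _ ?_
  · intro y _
    by_cases h : y = act t p
    · simp [h]
    by_cases h' : y = act t q
    · simp [h', hp1]
    by_cases h'' : y = w₀
    · simpa [h'', hp2, hq2] using hrw
    · simp only [h, h', h'', if_false]
      exact ht y
  · have : ∀ F : Ω → Ω, F (act t p) ∈ (insert (act t q) W).image F →
        ((insert (act t p) (insert (act t q) W)).image F).card < n := by
      intro F hF
      rw [Finset.image_insert, Finset.insert_eq_of_mem hF]
      have := Finset.card_image_le (s := insert (act t q) W) (f := F)
      omega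
    refine this _ ?_
    by_cases hj : j = i
    · subst hj
      exact Finset.mem_image.2 ⟨w₀, by simp [hw₀], by simp [hp2, hq2, hr]⟩
    · exact Finset.mem_image.2 ⟨act t q, by simp, by simp [hp1, hpq j hj]⟩

theorem full_of_twin (hn : 2 ≤ n) (hK : IsTotallySymmetric C n K) (h : ∀ a b, Twin n K a b)
    (X : Finset Ω) (hX : X.card ≤ n) : K X := by
  by_cases hs : X.card < n
  · exact hK.small _ hs
  obtain ⟨a, ha⟩ : X.Nonempty := by rw [← Finset.card_pos]; omega
  have h1 := Finset.card_erase_of_mem ha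
  obtain ⟨b, hb⟩ : (X.erase a).Nonempty := by rw [← Finset.card_pos]; omega
  have h2 := Finset.card_erase_of_mem hb
  have := h a b ((X.erase a).erase b) (by omega)
  rwa [Finset.insert_erase hb, Finset.insert_erase ha] at this

/-- An algebra with a transitive operation that absorbs no proper subalgebra has only trivial
totally symmetric relations. -/
theorem full [Finite Ω] [Nonempty Ω] (hc : IsCore C Ω) {ι : Type} [Finite ι]
    {t : C.Op ι} (ht : IsIdempotentOp Ω t) (htr : IsTransitiveOp Ω t)
    (hno : ∀ Z : Set Ω, IsSubalgebra C Z → AbsorbedBy Z t → Z.Nonempty → Z = Set.univ) :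
    ∀ (k n : ℕ), 2 ≤ n → Nat.card Ω < n + k → ∀ K : Finset Ω → Prop, IsTotallySymmetric C n K →
      (n = 2 → ∀ a b, Relation.ReflTransGen (fun a b => K {a, b}) a b) →
      ∀ X : Finset Ω, X.card ≤ n → K X := by
  have := Fintype.ofFinite Ω
  intro k
  induction k with
  | zero =>
    intro n hn hcard K hK _ X _
    refine hK.small X (lt_of_le_of_lt (Finset.card_le_univ X) ?_)
    rw [← Nat.card_eq_fintype_card]; exact hcard
  | succ k ih =>
    intro n hn hcard
    by_contra hcon
    push Not at hcon
    obtain ⟨K₀, h₀, hconn₀, hX₀⟩ := hcon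
    -- A maximal counterexample: either `Extends n K` is full at arity `n`, or it coincides with
    -- `K`.
    obtain ⟨K, ⟨hK, hconn, X₁, hX₁, hX₁K⟩, hmax⟩ := (Set.toFinite {K : Finset Ω → Prop |
      IsTotallySymmetric C n K ∧
      (n = 2 → ∀ a b, Relation.ReflTransGen (fun a b => K {a, b}) a b) ∧
      ∃ X : Finset Ω, X.card ≤ n ∧ ¬ K X}).exists_maximal ⟨K₀, h₀, hconn₀, hX₀⟩
    have hle : K ≤ Extends n K := fun X hX => hK.le_extends hn hX
    have hE : ∀ m, (∀ X : Finset Ω, X.card < m → Extends n K X) →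
        IsTotallySymmetric C m (Extends n K) := fun m hm =>
      ⟨fun X Y h hY => hY.mono h, hm, fun ι _ f Y w _ h1 h2 => hK.extends_inv ι f Y w h1 h2⟩
    by_cases hfull : ∀ X : Finset Ω, X.card ≤ n → Extends n K X
    -- Fullness climbs through the arities by the induction hypothesis, so some element is
    -- compatible with everything and the centre is nonempty.
    · have hall : ∀ m, n ≤ m → ∀ X : Finset Ω, X.card ≤ m → Extends n K X := by
        intro m hm
        induction m, hm using Nat.le_induction with
        | base => exact hfull
        | succ m hm ihm =>
          exact ih (m + 1) (by omega) (by omega) _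
            (hE (m + 1) fun X hX => ihm X (by omega)) (by omega)
      obtain ⟨z, hz⟩ := hall (n + Finset.univ.card) (by omega) (Finset.univ : Finset Ω) (by omega)
      have hZ := hno _ (hK.isSubalgebra_center hc) (hK.absorbedBy_center hn ht htr)
        ⟨z, fun Y hY => hz Y (Finset.subset_univ _) hY⟩
      rcases X₁.eq_empty_or_nonempty with rfl | ⟨x, hx⟩
      · exact hX₁K (hK.small _ (by simp; omega))
      · have hxZ : x ∈ {z | ∀ Y : Finset Ω, Y.card < n → K (insert z Y)} := hZ ▸ Set.mem_univ x
        have := hxZ (X₁.erase x) (by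
          have := Finset.card_erase_of_mem hx
          have := Finset.card_pos.2 ⟨x, hx⟩
          omega)
        rw [Finset.insert_erase hx] at this
        exact hX₁K this
    · push Not at hfull
      have hext : Extends n K ≤ K := hmax ⟨hE n fun X hX => hle X (hK.small X hX),
        fun h2 a b => Relation.ReflTransGen.mono (fun a b h => hle {a, b} h) a b (hconn h2 a b), hfull⟩ hle
      refine hX₁K (hK.full_of_twin hn (fun a b => ?_) X₁ hX₁)
      -- Being twins is transitive. For `n = 2` connectivity finishes; for larger `n`, the constant
      -- tuples at `a` and `b` are joined by changing one argument of `t` at a time.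
      have htrans := fun (a b c : Ω) => hK.twin_trans (a := a) (b := b) (c := c) hext
      by_cases h2 : n = 2
      · have := hconn h2 a b
        induction this with
        | refl => exact hK.twin_refl a
        | tail _ h ih =>
          refine htrans _ _ _ ih fun W hW => ?_
          rw [Finset.card_eq_zero.1 (by omega : W.card = 0)]
          exact h
      · have := rel_of_update (r := Twin n K) hK.twin_refl htrans (act t) (fun _ => a)
          (fun _ => b) fun i p q _ hpq _ _ => hK.twin_act (by omega) ht htr i p q hpq
        rwa [show act t (fun _ : ι => a) = a from ht a,
          show act t (fun _ : ι => b) = b from ht b] at this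

end IsTotallySymmetric

end TotallySymmetric

/-! ### The loop theorem -/

section LoopTheorem

variable {C : AbstractClone.{w}} {Ω : Type w'} [CloneAction C Ω]

theorem exists_loop_of_transitive [Finite Ω] [Nonempty Ω] (hc : IsCore C Ω) {ι : Type} [Finite ι]
    {t : C.Op ι} (ht : IsIdempotentOp Ω t) (htr : IsTransitiveOp Ω t)
    (hno : ∀ Z : Set Ω, IsSubalgebra C Z → AbsorbedBy Z t → Z.Nonempty → Z = Set.univ)
    {R : Ω → Ω → Prop} (hR : PreservesRel C R) (hs : IsSmooth R) (hl : IsLinked R) :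
    ∃ x, R x x := by
  classical
  have := Fintype.ofFinite Ω
  have hfull := fun n hn => IsTotallySymmetric.full hc ht htr hno (Nat.card Ω) n hn (by omega)
  have hrefl : ∀ x, Forked R x x := fun x => by
    obtain ⟨y, hy⟩ := hs.1 x
    exact ⟨y, hy, hy⟩
  -- Linkedness is the connectivity required of binary relations.
  have hF : ∀ x y, Forked R x y := by
    intro x y
    refine hfull 2 le_rfl (fun X => ∀ x ∈ X, ∀ y ∈ X, Forked R x y) ⟨?_, ?_, ?_⟩ ?_ {x, y}
      Finset.card_le_two x (by simp) y (by simp)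
    · exact fun X Y h hY x hx y hy => hY x (h hx) y (h hy)
    · intro X hX x hx y hy
      rw [Finset.card_le_one.1 (by omega) x hx y hy]
      exact hrefl y
    · intro κ _ f Y w _ hw h x hx y hy
      choose z hz1 hz2 using fun i => h i _ (Finset.mem_image_of_mem _ hx) _
        (Finset.mem_image_of_mem _ hy)
      rw [← hw x hx, ← hw y hy]
      exact ⟨act f z, hR κ f _ _ hz1, hR κ f _ _ hz2⟩
    · refine fun _ a b => Relation.ReflTransGen.mono ?_ a b (hl a b)
      intro a b h
      have h' : Forked R b a := h.imp fun z hz => hz.symm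
      simp [h, h', hrefl]
  -- Having a common out-neighbour at arity `m` makes the relation of arity `m + 1` totally
  -- reflexive, hence full.
  have hall : ∀ m, 2 ≤ m → ∀ X : Finset Ω, X.card ≤ m → ∃ d, ∀ x ∈ X, R x d := by
    intro m hm
    induction m, hm using Nat.le_induction with
    | base =>
      intro X hX
      rcases X.eq_empty_or_nonempty with rfl | ⟨a, ha⟩
      · exact ⟨Classical.arbitrary Ω, by simp⟩
      have h1 := Finset.card_erase_of_mem ha
      rcases (X.erase a).eq_empty_or_nonempty with h0 | ⟨b, hb⟩
      · obtain ⟨d, hd⟩ := hs.1 a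
        refine ⟨d, fun x hx => ?_⟩
        by_cases hxa : x = a
        · rwa [hxa]
        · have : x ∈ X.erase a := Finset.mem_erase.2 ⟨hxa, hx⟩
          simp [h0] at this
      · obtain ⟨d, hd1, hd2⟩ := hF a b
        refine ⟨d, fun x hx => ?_⟩
        by_cases hxa : x = a
        · rwa [hxa]
        · rwa [Finset.card_le_one.1 (by omega) x (Finset.mem_erase.2 ⟨hxa, hx⟩) b hb]
    | succ m hm ih =>
      refine hfull (m + 1) (by omega) (fun X => ∃ d, ∀ x ∈ X, R x d) ⟨?_, ?_, ?_⟩ (by omega)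
      · rintro X Y h ⟨d, hd⟩
        exact ⟨d, fun x hx => hd x (h hx)⟩
      · exact fun X hX => ih X (by omega)
      · intro κ _ f Y w _ hw h
        choose d hd using h
        refine ⟨act f d, fun y hy => ?_⟩
        rw [← hw y hy]
        exact hR κ f _ _ fun i => hd i _ (Finset.mem_image_of_mem _ hy)
  obtain ⟨d, hd⟩ := hall (2 + (Finset.univ : Finset Ω).card) (by omega) Finset.univ (by omega)
  exact ⟨d, hd d (Finset.mem_univ d)⟩

/-- A linked smooth digraph that is invariant under a clone whose unary operations are
permutations has a loop, unless the clone has a homomorphism to the projections. -/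
theorem exists_loop_or_hasProjHom (C : AbstractClone.{w}) (n : ℕ) : ∀ (Ω : Type w')
    [CloneAction C Ω] [Finite Ω] [Nonempty Ω], Nat.card Ω ≤ n → IsCore C Ω →
    ∀ R : Ω → Ω → Prop, PreservesRel C R → IsSmooth R → IsLinked R →
      (∃ x, R x x) ∨ C.HasProjHom := by
  induction n with
  | zero =>
    intro Ω _ _ _ hn
    exact absurd (Nat.card_pos (α := Ω)) (by omega)
  | succ n ih =>
    intro Ω _ _ _ hn hc R hR hs hl
    have habs : ∀ (ι : Type) [Finite ι] (f : C.Op ι) (Z : Set Ω), IsSubalgebra C Z →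
        AbsorbedBy Z f → Z.Nonempty → Z ≠ Set.univ → (∃ x, R x x) ∨ C.HasProjHom := by
      intro ι _ f Z hZ hZf hne hZu
      obtain ⟨B, hB, hBne, hBu, hBs, hBl⟩ := exists_restriction hc hR hs hl hZ hZf hne hZu
      -- The same clone acts on `B`, so a homomorphism found there needs no transfer.
      let _ := hB.action
      have := hBne.to_subtype
      have hlt : Nat.card B < Nat.card Ω := by
        have := Set.ncard_lt_ncard (Set.ssubset_univ_iff.2 hBu) (Set.toFinite _)
        rwa [Set.ncard_univ] at this
      refine (ih B (by omega) ?_ (fun x y => R x y) ?_ hBs hBl).imp (fun ⟨x, hx⟩ => ⟨x, hx⟩) id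
      · exact fun κ _ g x y hxy => Subtype.ext (hc κ g (congrArg Subtype.val hxy))
      · exact fun κ _ g v w h => hR κ g _ _ h
    rcases exists_transitive_or (C := C) (Ω := Ω) with ⟨ι, _, t, ht, htr⟩ | ⟨P, hP1, hP2, hP⟩
    · by_cases hno : ∀ Z : Set Ω, IsSubalgebra C Z → AbsorbedBy Z t → Z.Nonempty → Z = Set.univ
      · exact Or.inl (exists_loop_of_transitive hc ht htr hno hR hs hl)
      · push Not at hno
        obtain ⟨Z, h1, h2, h3, h4⟩ := hno
        exact habs ι t Z h1 h2 h3 h4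
    · by_cases hsub : ∀ (ι : Type) [Finite ι] (f : C.Op ι), (forcing P f).Subsingleton
      · exact Or.inr (hasProjHom_of_forcing_subsingleton hc hP hsub)
      · push Not at hsub
        obtain ⟨ι, _, f, hf⟩ := hsub
        obtain ⟨i, hi, i', hi', hne⟩ := hf
        obtain ⟨h1, b, hb⟩ := exists_absorbing_of_forcing hc hP f hi hi' hne
        exact habs Bool b P h1 hb hP1 hP2

end LoopTheorem

end CloneAction

/-! ### Invariant relations, pp-definability and interpretations -/

section PPDefinability

open FirstOrder.Language

/-- The operation `f` with arguments indexed by `ι` preserves all relations of the structure. -/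
def Preserves (L : FirstOrder.Language.{u, v}) {A : Type w} [L.Structure A] {ι : Type}
    (f : (ι → A) → A) : Prop :=
  ∀ (n : ℕ) (R : L.Relations n) (r : ι → Fin n → A),
    (∀ i, Structure.RelMap R (r i)) → Structure.RelMap R fun j => f fun i => r i j

/-- The polymorphism clone of a structure. -/
def polClone (L : FirstOrder.Language.{u, v}) (A : Type w) [L.Structure A] :
    AbstractClone.{w} where
  Op ι := {f : (ι → A) → A // Preserves L f}
  proj i := ⟨fun x => x i, fun _ _ _ h => h i⟩
  comp f g := ⟨fun x => f.1 fun i => (g i).1 x, fun n R r h =>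
    f.2 n R (fun i j => (g i).1 fun k => r k j) fun i => (g i).2 n R r h⟩
  proj_comp _ _ := rfl
  comp_proj _ := rfl
  comp_assoc _ _ _ := rfl

variable {L : FirstOrder.Language.{u, v}} {A : Type w} [L.Structure A]

theorem realize_term_of_isRelational [L.IsRelational] {β : Type*} (t : L.Term β) {ι : Type}
    (f : (ι → A) → A) (x : ι → β → A) :
    t.realize (fun b => f fun i => x i b) = f fun i => t.realize (x i) := by
  cases t with
  | var b => rfl
  | func g ts => exact isEmptyElim g

theorem IsPrimitivePositive.realize_of_preserves [L.IsRelational] {α : Type u'} {n : ℕ}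
    {φ : L.BoundedFormula α n} (hφ : IsPrimitivePositive φ) {ι : Type} {f : (ι → A) → A}
    (hf : Preserves L f) : ∀ (x : ι → α → A) (y : ι → Fin n → A),
      (∀ i, φ.Realize (x i) (y i)) →
        φ.Realize (fun a => f fun i => x i a) fun j => f fun i => y i j := by
  have hsum : ∀ {n : ℕ} (x : ι → α → A) (y : ι → Fin n → A),
      Sum.elim (fun a => f fun i => x i a) (fun j => f fun i => y i j) =
        fun b => f fun i => Sum.elim (x i) (y i) b := by
    intro n x y
    funext b
    cases b <;> rfl
  induction hφ with
  | of_isAtomic h =>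
    intro x y hxy
    cases h with
    | equal t₁ t₂ =>
      simp only [BoundedFormula.realize_bdEqual, hsum, realize_term_of_isRelational] at hxy ⊢
      simp only [hxy]
    | rel R ts =>
      simp only [BoundedFormula.realize_rel, hsum, realize_term_of_isRelational] at hxy ⊢
      exact hf _ R _ hxy
  | inf _ _ ih₁ ih₂ =>
    intro x y hxy
    simp only [BoundedFormula.realize_inf] at hxy ⊢
    exact ⟨ih₁ x y fun i => (hxy i).1, ih₂ x y fun i => (hxy i).2⟩
  | ex _ ih =>
    intro x y hxy
    simp only [BoundedFormula.realize_ex] at hxy ⊢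
    choose c hc using hxy
    refine ⟨f c, ?_⟩
    have := ih x _ hc
    convert this using 1
    funext j
    refine Fin.lastCases ?_ (fun j => ?_) j <;> simp

theorem IsPPDefinable.mem_of_preserves [L.IsRelational] {α : Type u'} {S : Set (α → A)}
    (hS : IsPPDefinable L S) {ι : Type} {f : (ι → A) → A} (hf : Preserves L f)
    (x : ι → α → A) (hx : ∀ i, x i ∈ S) : (fun a => f fun i => x i a) ∈ S := by
  obtain ⟨φ, hφ, hφS⟩ := hS
  rw [← hφS]
  have := hφ.realize_of_preserves hf x (fun _ => default) fun i => (hφS _).2 (hx i)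
  rw [Formula.Realize]
  convert this using 1

theorem exists_isPrimitivePositive_iff_forall {α : Type u'} {n : ℕ} (hn : 0 < n) {κ : Type*}
    [Finite κ] (φ : κ → L.BoundedFormula α n) (hφ : ∀ k, IsPrimitivePositive (φ k)) :
    ∃ ψ : L.BoundedFormula α n, IsPrimitivePositive ψ ∧ ∀ (x : α → A) (y : Fin n → A),
      ψ.Realize x y ↔ ∀ k, (φ k).Realize x y := by
  classical
  have := Fintype.ofFinite κ
  have key : ∀ s : Finset κ, ∃ ψ : L.BoundedFormula α n, IsPrimitivePositive ψ ∧
      ∀ (x : α → A) (y : Fin n → A), ψ.Realize x y ↔ ∀ k ∈ s, (φ k).Realize x y := by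
    intro s
    induction s using Finset.induction_on with
    | empty =>
      refine ⟨(Term.var (Sum.inr ⟨0, hn⟩)).bdEqual (Term.var (Sum.inr ⟨0, hn⟩)),
        .of_isAtomic (.equal _ _), fun x y => ?_⟩
      simp
    | insert k s _ ih =>
      obtain ⟨ψ, h₁, h₂⟩ := ih
      refine ⟨φ k ⊓ ψ, (hφ k).inf h₁, fun x y => ?_⟩
      simp [h₂]
  simpa using key Finset.univ

theorem IsPrimitivePositive.exs {α : Type u'} : ∀ {n : ℕ} {φ : L.BoundedFormula α n},
    IsPrimitivePositive φ → IsPrimitivePositive φ.exs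
  | 0, _, h => h
  | _ + 1, φ, h => IsPrimitivePositive.exs (φ := φ.ex) h.ex

/-- On a finite structure, relations that are invariant under all polymorphisms are
pp-definable. -/
theorem isPPDefinable_of_forall_preserves [Finite A] [Nonempty A] {α : Type u'} [Finite α]
    {S : Set (α → A)} (hS : ∀ (k : ℕ) (f : (Fin k → A) → A), Preserves L f →
      ∀ x : Fin k → α → A, (∀ i, x i ∈ S) → (fun a => f fun i => x i a) ∈ S) :
    IsPPDefinable L S := by
  obtain ⟨k, ⟨s⟩⟩ := Finite.exists_equiv_fin S
  obtain ⟨N, ⟨e⟩⟩ := Finite.exists_equiv_fin (Fin k → A)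
  have hN : 0 < N := by
    have : Nonempty (Fin N) := e.nonempty_congr.1 inferInstance
    exact Fin.pos_iff_nonempty.2 this
  have hbad : ∀ f : {f : (Fin k → A) → A // ¬ Preserves L f}, ∃ (n : ℕ) (R : L.Relations n)
      (r : Fin k → Fin n → A), (∀ i, Structure.RelMap R (r i)) ∧
        ¬ Structure.RelMap R fun j => f.1 fun i => r i j := by
    rintro ⟨f, hf⟩
    simp only [Preserves] at hf
    push Not at hf
    exact hf
  choose n R r hr hr' using hbad
  -- The variables, indexed by `A^k`, tabulate an operation. One violated constraint per
  -- non-polymorphism keeps the conjunction finite for any signature; the equalities make the free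
  -- tuple its value on the list of all elements of `S`.
  let φ : {f : (Fin k → A) → A // ¬ Preserves L f} ⊕ α → L.BoundedFormula α N :=
    Sum.elim
      (fun f => (R f).boundedFormula fun j => Term.var (Sum.inr (e fun i => r f i j)))
      (fun a => (Term.var (Sum.inl a)).bdEqual
        (Term.var (Sum.inr (e fun i => (s.symm i : α → A) a))))
  obtain ⟨ψ, h₁, h₂⟩ := exists_isPrimitivePositive_iff_forall (A := A) hN φ (by
    rintro (f | a)
    · exact .of_isAtomic (.rel _ _)
    · exact .of_isAtomic (.equal _ _))
  refine ⟨ψ.exs, h₁.exs, fun a => ?_⟩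
  rw [BoundedFormula.realize_exs]
  constructor
  · rintro ⟨y, hy⟩
    rw [h₂] at hy
    have hf : Preserves L fun x => y (e x) := by
      by_contra hf
      have := hy (Sum.inl ⟨_, hf⟩)
      simp only [φ, Sum.elim_inl, BoundedFormula.realize_rel] at this
      exact hr' ⟨_, hf⟩ this
    have ha : a = fun b => y (e fun i => (s.symm i : α → A) b) := by
      funext b
      have := hy (Sum.inr b)
      simpa [φ] using this
    rw [ha]
    exact hS k _ hf (fun i => s.symm i) fun i => (s.symm i).2
  · intro ha
    refine ⟨fun j => e.symm j (s ⟨a, ha⟩), (h₂ _ _).2 ?_⟩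
    rintro (f | b)
    · simp only [φ, Sum.elim_inl, BoundedFormula.realize_rel]
      simpa using hr f (s ⟨a, ha⟩)
    · simp [φ]

/-- A tuple indexed by `B → A` is a `B`-ary operation; if it is a polymorphism, `ξ` sends it to an
element of `B`. Compatibility with composition makes all preimages invariant. -/
theorem ppInterpretsAllFinite_of_hasProjHom [Finite A] [Nonempty A]
    (h : (polClone L A).HasProjHom) : PPInterpretsAllFinite L A := by
  obtain ⟨ξ, hproj, hcomp⟩ := h
  intro L' _ B _ _
  obtain ⟨d, ⟨e⟩⟩ := Finite.exists_equiv_fin (B → A)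
  let h : (Fin d → A) →. B := fun a =>
    ⟨Preserves L fun x : B → A => a (e x), fun hp => ξ B ⟨_, hp⟩⟩
  have key : ∀ (n : ℕ) (R : Set (Fin n → B)), IsPPDefinable L (blockPreimage h R) := by
    intro n R
    refine isPPDefinable_of_forall_preserves fun k f hf x hx => ?_
    choose b hbR hb using hx
    choose hp hp' using hb
    let F : (polClone L A).Op (Fin k) := ⟨f, hf⟩
    refine ⟨b (ξ _ F), hbR _, fun j => ?_⟩
    let g : Fin k → (polClone L A).Op B := fun i => ⟨fun y => x i (j, e y), hp i j⟩
    exact ⟨((polClone L A).comp F g).2, (hcomp _ _ F g).trans (hp' _ _)⟩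
  refine ⟨d, h, ?_, fun b => ⟨fun i => e.symm i b, ?_, ?_⟩, key _ _, key _ _, fun n R => key n _⟩
  · have : Nonempty (Fin d) := e.nonempty_congr.1 inferInstance
    exact Fin.pos_iff_nonempty.2 this
  · intro n R r hr
    simpa using hr b
  · refine (congrArg (ξ B) (Subtype.ext (funext fun x => ?_))).trans (hproj B b)
    exact congrFun (e.symm_apply_apply x) b

end PPDefinability

/-! ### Equational conditions and triviality -/

section Conditions

open FirstOrder.Language

/-- The two-element structure with all relations. -/
def fullLanguage : FirstOrder.Language.{0, 0} := ⟨fun _ => Empty, fun n => Set (Fin n → Bool)⟩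

instance : fullLanguage.IsRelational := fun _ => inferInstanceAs (IsEmpty Empty)

instance : fullLanguage.Structure Bool where
  funMap f := f.elim
  RelMap R b := b ∈ (show Set _ from R)

theorem exists_eq_proj_of_isPolymorphism_full {k : ℕ} {f : (Fin k → Bool) → Bool}
    (hf : IsPolymorphism fullLanguage f) : ∃ j, ∀ x, f x = x j := by
  obtain ⟨N, ⟨e⟩⟩ := Finite.exists_equiv_fin (Fin k → Bool)
  obtain ⟨j, hj⟩ := hf N {c : Fin N → Bool | ∃ j, ∀ n, c n = e.symm n j} (fun j n => e.symm n j)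
    fun j => ⟨j, fun n => rfl⟩
  refine ⟨j, fun x => ?_⟩
  simpa using hj (e x)

section TrivialityFromInterpretation

variable {L : FirstOrder.Language.{u, v}} [L.IsRelational] {A : Type w} [L.Structure A] [Finite A]

/-- Listing all admissible pairs `(a, b)` in one relation, whose members are the `k` coordinate
selections, makes the same `j` work for all of them. -/
theorem exists_proj_of_ppInterprets {d : ℕ} {h : (Fin d → A) →. Bool}
    (hR : ∀ (n : ℕ) (R : Set (Fin n → Bool)), IsPPDefinable L (blockPreimage h R)) {k : ℕ}
    {f : (Fin k → A) → A} (hf : IsPolymorphism L f) :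
    ∃ j, ∀ (a : Fin k → Fin d → A) (b : Fin k → Bool), (∀ i, b i ∈ h (a i)) →
      b j ∈ h fun c => f fun i => a i c := by
  obtain ⟨N, ⟨e⟩⟩ := Finite.exists_equiv_fin
    {q : (Fin k → Fin d → A) × (Fin k → Bool) // ∀ i, q.2 i ∈ h (q.1 i)}
  have := (hR N {c | ∃ j, ∀ n, c n = (e.symm n).1.2 j}).mem_of_preserves (f := f) hf
    (fun i p => (e.symm p.1).1.1 i p.2)
    fun i => ⟨fun n => (e.symm n).1.2 i, ⟨i, fun n => rfl⟩, fun n => (e.symm n).2 i⟩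
  obtain ⟨c, ⟨j, hj⟩, hc⟩ := this
  refine ⟨j, fun a b hab => ?_⟩
  have := hc (e ⟨(a, b), hab⟩)
  rw [hj] at this
  simpa using this

theorem EquationalCondition.isTrivial_of_ppInterpretsAllFinite (hA : PPInterpretsAllFinite L A)
    {E : EquationalCondition} (hE : E.SatisfiedBy L A) : E.IsTrivial := by
  obtain ⟨d, h, -, hsurj, -, -, hR⟩ := hA fullLanguage Bool
  obtain ⟨I, hI, hid⟩ := hE
  choose rep hrep using hsurj
  choose J hJ using fun k (s : E.symbols.Functions k) =>
    exists_proj_of_ppInterprets (L := L) (h := h) (fun n R => hR n R) (hI k s)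
  have hrel : ∀ n, IsEmpty (E.symbols.Relations n) := E.isAlgebraic
  let P : ∀ X : Type, E.symbols.Structure X := fun X =>
    ⟨fun {k} s v => v (J k s), fun {n} r _ => ((hrel n).false r).elim⟩
  have hleaf : ∀ t : E.symbols.Term ℕ, ∃ n : ℕ,
      (∀ (X : Type) (a : ℕ → X), @Term.realize _ X (P X) _ a t = a n) ∧
      ∀ (x : ℕ → Bool) (a : ℕ → Fin d → A), (∀ i, x i ∈ h (a i)) →
        x n ∈ h fun c => t.realize fun i => a i c := by
    intro t
    induction t with
    | var n => exact ⟨n, fun _ _ => rfl, fun x a hx => hx n⟩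
    | func s ts ih =>
      choose n h₁ h₂ using ih
      exact ⟨n (J _ s), fun X a => h₁ _ X a, fun x a hx => hJ _ s
        (fun i c => (ts i).realize fun m => a m c) (fun i => x (n i)) fun i => h₂ i x a hx⟩
  intro L' _ C _
  refine ⟨P C, fun k f n R r hr => hr (J k f), fun p hp a => ?_⟩
  obtain ⟨n₁, h₁, h₁'⟩ := hleaf p.1
  obtain ⟨n₂, h₂, h₂'⟩ := hleaf p.2
  have heq : n₁ = n₂ := by
    -- This assignment separates `n₁` from every other variable, and `h` is single-valued.
    let x : ℕ → Bool := fun i => decide (i = n₁)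
    have e₁ := h₁' x (fun i => rep (x i)) fun i => hrep _
    have e₂ := h₂' x (fun i => rep (x i)) fun i => hrep _
    simp only [hid p hp] at e₁
    have := Part.mem_unique e₁ e₂
    simpa [x, eq_comm] using this
  rw [h₁, h₂, heq]

end TrivialityFromInterpretation

/-- The symbols `h` and `α₁, …, αₘ`. -/
def siggersLikeLanguage (m : ℕ) : FirstOrder.Language.{0, 0} :=
  ⟨fun k => {s : Option (Fin m) // s.elim (m + 6) (fun _ => 1) = k}, fun _ => Empty⟩

def siggersLikeMain (m : ℕ) : (siggersLikeLanguage m).Functions (m + 6) := ⟨none, rfl⟩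

def siggersLikeUnary {m : ℕ} (i : Fin m) : (siggersLikeLanguage m).Functions 1 := ⟨some i, rfl⟩

/-- The identity of `SatisfiesSiggersLikeIdentity` as an equational condition. -/
def siggersLikeCondition (m : ℕ) : EquationalCondition where
  symbols := siggersLikeLanguage m
  isAlgebraic := fun _ => inferInstanceAs (IsEmpty Empty)
  arity_pos := ⟨by rintro ⟨_ | _, h⟩ <;> simp at h⟩
  identities := {(Term.func (siggersLikeMain m)
      (Fin.append (fun i => Term.func (siggersLikeUnary i) ![Term.var 0])
        ![Term.var 0, Term.var 1, Term.var 0, Term.var 2, Term.var 1, Term.var 2]),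
    Term.func (siggersLikeMain m)
      (Fin.append (fun _ => Term.var 1)
        ![Term.var 1, Term.var 0, Term.var 2, Term.var 0, Term.var 2, Term.var 1]))}

theorem siggersLikeCondition_satisfiedBy_iff {L : FirstOrder.Language.{u, v}} {A : Type w}
    [L.Structure A] {m : ℕ} :
    (siggersLikeCondition m).SatisfiedBy L A ↔ SatisfiesSiggersLikeIdentity L A m := by
  have hl : ∀ (I : (siggersLikeLanguage m).Structure A) (a : ℕ → A),
      (Term.func (siggersLikeMain m)
      (Fin.append (fun i => Term.func (siggersLikeUnary i) ![Term.var 0])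
        ![Term.var 0, Term.var 1, Term.var 0, Term.var 2, Term.var 1, Term.var 2])).realize a =
      I.funMap (siggersLikeMain m)
        (Fin.append (fun i => I.funMap (siggersLikeUnary i) ![a 0])
          ![a 0, a 1, a 0, a 2, a 1, a 2]) := by
    intro I a
    rw [Term.realize_func]
    congr 1
    funext j
    refine Fin.addCases (fun i => ?_) (fun i => ?_) j
    · simp only [Fin.append_left, Term.realize_func]
      congr 1
      funext l
      fin_cases l
      rfl
    · simp only [Fin.append_right]
      fin_cases i <;> rfl
  have hr : ∀ (I : (siggersLikeLanguage m).Structure A) (a : ℕ → A),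
      (Term.func (siggersLikeMain m)
      (Fin.append (fun _ => Term.var 1)
        ![Term.var 1, Term.var 0, Term.var 2, Term.var 0, Term.var 2, Term.var 1])).realize a =
      I.funMap (siggersLikeMain m)
        (Fin.append (fun _ => a 1) ![a 1, a 0, a 2, a 0, a 2, a 1]) := by
    intro I a
    rw [Term.realize_func]
    congr 1
    funext j
    refine Fin.addCases (fun i => ?_) (fun i => ?_) j
    · simp only [Fin.append_left]
      rfl
    · simp only [Fin.append_right]
      fin_cases i <;> rfl
  constructor
  · rintro ⟨I, hI, hid⟩
    refine ⟨I.funMap (siggersLikeMain m), fun i => I.funMap (siggersLikeUnary i), hI _ _,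
      fun i => hI _ _, fun x y z => ?_⟩
    let a : ℕ → A := fun n => if n = 0 then x else if n = 1 then y else z
    have := hid _ rfl a
    exact (hl I a).symm.trans (this.trans (hr I a))
  · rintro ⟨h, α, hh, hα, hid⟩
    let I : (siggersLikeLanguage m).Structure A :=
      { funMap := fun {k} s x => match s with
          | ⟨none, e⟩ => h fun j => x (Fin.cast e j)
          | ⟨some i, e⟩ => α i fun j => x (Fin.cast e j)
        RelMap := fun r => r.elim }
    refine ⟨I, ?_, ?_⟩
    · rintro k ⟨_ | i, rfl⟩
      · exact hh
      · exact hα i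
    · rintro _ rfl a
      exact (hl I a).trans ((hid _ _ _).trans (hr I a).symm)

theorem siggersLikeCondition_not_isTrivial (m : ℕ) : ¬ (siggersLikeCondition m).IsTrivial := by
  intro h
  obtain ⟨f, α, hf, hα, hid⟩ := siggersLikeCondition_satisfiedBy_iff.1 (h fullLanguage Bool)
  obtain ⟨j, hj⟩ := exists_eq_proj_of_isPolymorphism_full hf
  simp only [hj] at hid
  revert hid
  refine Fin.addCases (fun i => ?_) (fun i => ?_) j
  · obtain ⟨l, hl⟩ := exists_eq_proj_of_isPolymorphism_full (hα i)
    simp only [Fin.append_left, hl]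
    fin_cases l
    intro hid
    simpa using hid true false false
  · simp only [Fin.append_right]
    fin_cases i <;> decide

end Conditions

/-! ### The free algebra on three generators -/

section Core

variable {L : FirstOrder.Language.{u, v}} {A : Type w} [L.Structure A]

/-- A clone acts on its operations of a given arity by composition. -/
instance AbstractClone.selfAction (C : AbstractClone.{w}) (κ : Type) : CloneAction C (C.Op κ) where
  act f g := C.comp f g
  act_proj i g := C.proj_comp i g
  act_comp f g h := C.comp_assoc f g h

/-- The endomorphism `x ↦ f(x, …, x)`. -/
def diagHom [L.IsRelational] {ι : Type} (f : (polClone L A).Op ι) : A →[L] A where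
  toFun x := f.1 fun _ => x
  map_fun' g := isEmptyElim g
  map_rel' R x h := f.2 _ R (fun _ => x) fun _ => h

variable [Finite A]

theorem IsModelCompleteCore.exists_equiv (hcore : IsModelCompleteCore L A) (e : A →[L] A) :
    ∃ σ : A ≃[L] A, ∀ a, e a = σ a := by
  have := Fintype.ofFinite A
  obtain ⟨σ, hσ⟩ := hcore e Finset.univ
  exact ⟨σ, fun a => hσ a (Finset.mem_univ a)⟩

theorem IsModelCompleteCore.isCore [L.IsRelational] (hcore : IsModelCompleteCore L A) (κ : Type) :
    CloneAction.IsCore (polClone L A) ((polClone L A).Op κ) := by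
  intro ι _ f g g' h
  obtain ⟨σ, hσ⟩ := hcore.exists_equiv (diagHom f)
  refine Subtype.ext (funext fun x => σ.injective ?_)
  rw [← hσ, ← hσ]
  exact congrFun (congrArg Subtype.val h) x

theorem satisfiesSiggersLikeIdentity_of_not_ppInterpretsAllFinite [L.IsRelational] [Nonempty A]
    (hcore : IsModelCompleteCore L A) {m : ℕ} (hm : Nat.card (A ≃[L] A) ≤ m)
    (hA : ¬ PPInterpretsAllFinite L A) : SatisfiesSiggersLikeIdentity L A m := by
  have hfin : Finite (A ≃[L] A) := Finite.of_injective (fun σ => (σ : A → A)) DFunLike.coe_injective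
  obtain ⟨σ, hσ⟩ : ∃ σ : Fin m → (A ≃[L] A), Function.Surjective σ := by
    have e := Finite.equivFin (A ≃[L] A)
    have hi : Function.Injective fun τ => Fin.castLE hm (e τ) :=
      (Fin.castLE_injective hm).comp e.injective
    have : Nonempty (A ≃[L] A) := ⟨Language.Equiv.refl L A⟩
    exact ⟨_, Function.invFun_surjective hi⟩
  let C := polClone L A
  let α : Fin m → C.Op (Fin 1) := fun i => ⟨fun x => σ i (x 0), fun n R r hr => by
    have := (σ i).map_rel R (r 0)
    exact this.2 (hr 0)⟩
  let X : Fin 3 → C.Op (Fin 3) := C.proj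
  let l : Fin (m + 6) → C.Op (Fin 3) :=
    Fin.append (fun i => C.comp (α i) fun _ => X 0) ![X 0, X 1, X 0, X 2, X 1, X 2]
  let r : Fin (m + 6) → C.Op (Fin 3) := Fin.append (fun _ => X 1) ![X 1, X 0, X 2, X 0, X 2, X 1]
  -- The subalgebra generated by the columns `(l j, r j)` of the identity.
  let R : C.Op (Fin 3) → C.Op (Fin 3) → Prop := fun p q =>
    ∃ f : C.Op (Fin (m + 6)), p = C.comp f l ∧ q = C.comp f r
  have hgen : ∀ j, R (l j) (r j) := fun j =>
    ⟨C.proj j, (C.proj_comp j l).symm, (C.proj_comp j r).symm⟩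
  have hα : ∀ i, R (C.comp (α i) fun _ => X 0) (X 1) := fun i => by
    simpa [l, r] using hgen (Fin.castAdd 6 i)
  have hK : ∀ i : Fin 6, R (![X 0, X 1, X 0, X 2, X 1, X 2] i) (![X 1, X 0, X 2, X 0, X 2, X 1] i) :=
    fun i => by simpa [l, r] using hgen (Fin.natAdd m i)
  have h01 : R (X 0) (X 1) := hK 0
  have h10 : R (X 1) (X 0) := hK 1
  have h02 : R (X 0) (X 2) := hK 2
  have h20 : R (X 2) (X 0) := hK 3
  have h12 : R (X 1) (X 2) := hK 4
  have h21 : R (X 2) (X 1) := hK 5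
  have hR : CloneAction.PreservesRel C R := by
    intro ι _ f p q h
    choose g hg hg' using h
    refine ⟨C.comp f g, ?_, ?_⟩
    · rw [C.comp_assoc]
      exact congrArg (C.comp f) (funext hg)
    · rw [C.comp_assoc]
      exact congrArg (C.comp f) (funext hg')
  have hs : CloneAction.IsSmooth R := by
    constructor
    · intro p
      refine ⟨C.comp p ![X 1, X 0, X 0], ?_⟩
      have := hR _ p X ![X 1, X 0, X 0] fun i => by fin_cases i <;> assumption
      rwa [show CloneAction.act p X = p from C.comp_proj p] at this
    · intro p
      refine ⟨C.comp p ![X 1, X 0, X 0], ?_⟩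
      have := hR _ p ![X 1, X 0, X 0] X fun i => by fin_cases i <;> assumption
      rwa [show CloneAction.act p X = p from C.comp_proj p] at this
  have hsymm : ∀ p q, Relation.ReflTransGen (CloneAction.Forked R) p q →
      Relation.ReflTransGen (CloneAction.Forked R) q p := by
    intro p q h
    induction h with
    | refl => exact .refl
    | tail _ h ih => exact ih.head (h.imp fun _ => And.symm)
  have hX : ∀ p, Relation.ReflTransGen (CloneAction.Forked R) (X 0) p := by
    intro p
    -- In a core `p(x, x, x)` is one of the listed automorphisms, and both `X 0` and its image under
    -- it point to `X 1`.
    have hunary : Relation.ReflTransGen (CloneAction.Forked R) (X 0) (C.comp p fun _ => X 0) := by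
      obtain ⟨τ, hτ⟩ := hcore.exists_equiv (diagHom p)
      obtain ⟨i, rfl⟩ := hσ τ
      have : C.comp p (fun _ => X 0) = C.comp (α i) fun _ => X 0 :=
        Subtype.ext (funext fun x => hτ (x 0))
      rw [this]
      exact .single ⟨X 1, h01, hα i⟩
    refine hunary.trans ?_
    -- In a triangle any two vertices have a common neighbour; applying `p` to these forks joins
    -- `p(X 0, X 0, X 0)` to `p`.
    have hXi : ∀ i, CloneAction.Forked R (X 0) (X i) := by
      intro i
      fin_cases i
      · exact ⟨X 1, h01, h01⟩
      · exact ⟨X 2, h02, h12⟩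
      · exact ⟨X 1, h01, h21⟩
    choose z hz hz' using hXi
    have := hR _ p _ _ hz
    have h2 := hR _ p _ _ hz'
    rw [show CloneAction.act p X = p from C.comp_proj p] at h2
    exact .single ⟨_, this, h2⟩
  have hl : CloneAction.IsLinked R := fun p q => (hsymm _ _ (hX p)).trans (hX q)
  have : Finite (C.Op (Fin 3)) := inferInstanceAs (Finite {f : ((Fin 3) → A) → A // Preserves L f})
  have : Nonempty (C.Op (Fin 3)) := ⟨X 0⟩
  rcases CloneAction.exists_loop_or_hasProjHom C _ (C.Op (Fin 3)) le_rfl (hcore.isCore _) R hR hs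
    hl with ⟨p, f, h₁, h₂⟩ | hproj
  · refine ⟨f.1, fun i => (α i).1, f.2, fun i => (α i).2, fun x y z => ?_⟩
    have := congrFun (congrArg Subtype.val (h₁.symm.trans h₂)) ![x, y, z]
    have e₁ : Fin.append (fun i => (α i).1 ![x]) ![x, y, x, z, y, z] =
        fun j => (l j).1 ![x, y, z] := by
      funext j
      refine Fin.addCases (fun i => ?_) (fun i => ?_) j
      · simp only [l, Fin.append_left]
        rfl
      · simp only [l, Fin.append_right]
        fin_cases i <;> rfl
    have e₂ : Fin.append (fun _ : Fin m => y) ![y, x, z, x, z, y] =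
        fun j => (r j).1 ![x, y, z] := by
      funext j
      refine Fin.addCases (fun i => ?_) (fun i => ?_) j
      · simp only [r, Fin.append_left]
        rfl
      · simp only [r, Fin.append_right]
        fin_cases i <;> rfl
    rw [e₁, e₂]
    exact this
  · exact absurd (ppInterpretsAllFinite_of_hasProjHom hproj) hA

end Core

theorem mainTheorem11 (L : FirstOrder.Language.{u, v}) [L.IsRelational] (A : Type w) [L.Structure A]
    [Finite A] (hcore : IsModelCompleteCore L A) (m : ℕ) (hm : Nat.card (A ≃[L] A) ≤ m) :
    List.TFAE [
      ¬ PPInterpretsAllFinite L A,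
      ∃ E : EquationalCondition, ¬ E.IsTrivial ∧ E.SatisfiedBy L A,
      SatisfiesSiggersLikeIdentity L A m] := by
  tfae_have 1 → 3 := by
    intro h
    rcases isEmpty_or_nonempty A with hA | hA
    -- Over an empty domain the identity is vacuous, so projections serve.
    · exact ⟨fun x => x (Fin.natAdd m 0), fun _ x => x 0, fun _ _ _ hr => hr _,
        fun _ _ _ _ hr => hr _, fun x => isEmptyElim x⟩
    · exact satisfiesSiggersLikeIdentity_of_not_ppInterpretsAllFinite hcore hm h
  tfae_have 3 → 2 := fun h =>
    ⟨siggersLikeCondition m, siggersLikeCondition_not_isTrivial m,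
      siggersLikeCondition_satisfiedBy_iff.2 h⟩
  tfae_have 2 → 1 := fun ⟨_, hE, hEA⟩ h =>
    hE (EquationalCondition.isTrivial_of_ppInterpretsAllFinite h hEA)
  tfae_finish
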